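/- **Setting.** Let $Q$ be a group, $\Gamma\subseteq Q$ a subsemigroup containing $1$, and write $g\le h$ if $g^{-1}h\in\Gamma$. Assume that $\Gamma$ is a *join-semilattice*: $\Gamma\cap\Gamma^{-1}=\{1\}$ and any two elements of $\Gamma$ have a (unique) least upper bound in $\Gamma$. Let $\Lambda$ be a left cancellative small category with source and range maps $s,r$ (the product $\alpha\beta$ is defined when $s(\alpha)=r(\beta)$) that is *finitely aligned*: for all $\alpha,\beta\in\Lambda$ the set $\alpha\Lambda\cap\beta\Lambda$ is a finite union of sets $\gamma\Lambda$. Assume that $\Lambda$ is a *$\Gamma$-graph*: there is a map $\mathbf d:\Lambda\to\Gamma$ with $\mathbf d(\alpha\beta)=\mathbf d(\alpha)\mathbf d(\beta)$ whenever $\alpha\beta$ is defined, and such that if $\mathbf d(\alpha)=g_1g_2$ with $g_1,g_2\in\Gamma$, then there are unique $\alpha_1,\alpha_2\in\Lambda$ with $\alpha=\alpha_1\alpha_2$, $\mathbf d(\alpha_1)=g_1$, $\mathbf d(\alpha_2)=g_2$. **Tight groupoid.** For $\alpha\in\Lambda$ let $\tau^\alpha:s(\alpha)\Lambda\to\alpha\Lambda$,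 $\beta\mapsto\alpha\beta$, and $\sigma^\alpha=(\tau^\alpha)^{-1}$. Let $\mathcal S_\Lambda$ be the inverse semigroup of partial bijections of $\Lambda$ generated by all $\tau^\alpha,\sigma^\alpha$, and $\mathcal E$ its semilattice of idempotents. A *filter* is a non-empty, upward closed subset of $\mathcal E$ that is closed under products and does not contain the empty map. The sets $\{\eta: X\subseteq\eta,\ Y\cap\eta=\emptyset\}$ with $X,Y\subseteq\mathcal E$ finite are a basis of the topology on the set of filters. The space $\widehat{\mathcal E}_{\rm tight}$ of *tight filters* is the closure of the set of maximal filters. For $s\in\mathcal S_\Lambda$ and $\xi\ni s^*s$ put $s\cdot\xi=\{f\in\mathcal E: ses^*\le f\text{ for some }e\in\xi\}$, and put $\Delta_\xi=\{\alpha\in\Lambda:\tau^\alpha\sigma^\alpha\in\xi\}$. The *tight groupoid* $\mathcal G_{\rm tight}(\mathcal S_\Lambda)$ is the groupoid of germs $[s,\xi]$ with $\xi\in\widehat{\mathcal E}_{\rm tight}$ and $s^*s\in\xi$, where $[s,\xi]=[t,\xi']$ iff $\xi=\xi'$ and $se=te$ for some $e\in\xi$. Its source and range maps are $[s,\xi]\mapsto\xi$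 and $[s,\xi]\mapsto s\cdot\xi$, its product is $[s,t\cdot\xi][t,\xi]=[st,\xi]$, and its topology has as basis the sets $\{[s,\xi]:\xi\in U\}$ with $U\subseteq\{\xi : s^*s\in\xi\}$ open. **Action groupoid.** For $g\in\Gamma$ let $U(g)$ be the set of $\xi\in\widehat{\mathcal E}_{\rm tight}$ for which there is $\alpha\in\Delta_\xi$ with $\mathbf d(\alpha)=g$ (such an $\alpha$ is unique), and put $T_g(\xi)=\sigma^\alpha\cdot\xi$. These partial maps form a directed semigroup action: $T_1=\mathrm{id}$, $T_{gh}=T_h\circ T_g$ as partial maps, and if $U(g)\cap U(h)\ne\emptyset$, then $U(g)\cap U(h)=U(r)$ for some $r\ge g,h$. The *semigroup action groupoid* $\mathcal G(\widehat{\mathcal E}_{\rm tight},\Gamma,T)$ is the set of triples $(x,gh^{-1},y)\in\widehat{\mathcal E}_{\rm tight}\times Q\times\widehat{\mathcal E}_{\rm tight}$ with $g,h\in\Gamma$, $x\in U(g)$, $y\in U(h)$ and $T_g(x)=T_h(y)$. Its range and source maps are the first and last coordinates, and its product is $(x,q,y)(y,q',z)=(x,qq',z)$. Its topology has as basis the sets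 $Z(A,g,h,B)=\{(x,gh^{-1},y): x\in A,\ y\in B,\ T_g(x)=T_h(y)\}$, where $A\subseteq U(g)$ and $B\subseteq U(h)$ are open, $T_g|_A$ and $T_h|_B$ are injective, and $T_g(A)=T_h(B)$. **Proposition.** Both groupoids are topological groupoids, and every element of $\mathcal G_{\rm tight}(\mathcal S_\Lambda)$ is of the form $[\tau^\alpha\sigma^\beta,\xi]$ with $s(\alpha)=s(\beta)$ and $\beta\in\Delta_\xi$. The maps $$\bar{\mathbf d}:\mathcal G_{\rm tight}(\mathcal S_\Lambda)\to Q,\qquad [\tau^\alpha\sigma^\beta,\xi]\mapsto\mathbf d(\alpha)\mathbf d(\beta)^{-1},$$ $$\Phi:\mathcal G_{\rm tight}(\mathcal S_\Lambda)\to\mathcal G(\widehat{\mathcal E}_{\rm tight},\Gamma,T),\qquad [\tau^\alpha\sigma^\beta,\xi]\mapsto(\tau^\alpha\sigma^\beta\cdot\xi,\ \mathbf d(\alpha)\mathbf d(\beta)^{-1},\ \xi)$$ are well defined, and $\Phi$ is an isomorphism of topological groupoids. Both $\bar{\mathbf d}$ and $\bar{\mathbf c}:(x,q,y)\mapsto q$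 are continuous groupoid homomorphisms to the discrete group $Q$, and $\bar{\mathbf c}\circ\Phi=\bar{\mathbf d}$. -/

import Mathlib

open CategoryTheory Topology

namespace LCSC

section PartialBijections

variable {X : Type*}

/-- Product of partial bijections: `f * g` is `f ∘ g` on its largest domain. With this product
`X ≃. X` is the symmetric inverse semigroup of `X`; the inverse of `f` is `f.symm` and the zero
element is the empty map `⊥`. -/
instance : Semigroup (X ≃. X) where
  mul f g := g.trans f
  mul_assoc f g h := (PEquiv.trans_assoc h g f).symm

theorem mem_mul {f g : X ≃. X} {a c : X} : c ∈ (f * g) a ↔ ∃ b, b ∈ g a ∧ c ∈ f b :=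
  PEquiv.mem_trans g f a c

theorem mem_symm {f : X ≃. X} {a b : X} : a ∈ f.symm b ↔ b ∈ f a := PEquiv.mem_iff_mem f

theorem mem_fun {f : X ≃. X} {a b c : X} (h : b ∈ f a) (h' : c ∈ f a) : b = c :=
  Option.mem_unique h h'

theorem mem_inj {f : X ≃. X} {a b c : X} (h : c ∈ f a) (h' : c ∈ f b) : a = b := f.inj h h'

theorem pext {f g : X ≃. X} (h : ∀ a b, b ∈ f a ↔ b ∈ g a) : f = g :=
  PEquiv.ext fun a => Option.ext fun b => h a b

theorem idem_iff {e : X ≃. X} : e * e = e ↔ ∀ a b, b ∈ e a → b = a := by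
  constructor
  · intro h a b hb
    have h1 : b ∈ (e * e) a := by rw [h]; exact hb
    obtain ⟨c, hc, hbc⟩ := mem_mul.1 h1
    obtain rfl := mem_fun hb hc
    exact mem_inj hbc hb
  · intro h
    refine pext fun a b => ?_
    rw [mem_mul]
    constructor
    · rintro ⟨c, hc, hb⟩
      obtain rfl := h _ _ hc
      exact hb
    · intro hb
      obtain rfl := h _ _ hb
      exact ⟨b, hb, hb⟩

theorem symm_mul (f g : X ≃. X) : (f * g).symm = g.symm * f.symm := rfl

/-- The partial bijection with graph `R`, for a relation `R` that is functional and injective. -/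
noncomputable def ofRel (R : X → X → Prop) (hf : ∀ a b c, R a b → R a c → b = c)
    (hi : ∀ a b c, R a c → R b c → a = b) : X ≃. X where
  toFun a := open Classical in if h : ∃ b, R a b then some h.choose else none
  invFun b := open Classical in if h : ∃ a, R a b then some h.choose else none
  inv a b := by
    constructor
    · intro h
      split_ifs at h with h1
      obtain rfl : h1.choose = a := by simpa using h
      have h2 : ∃ b', R h1.choose b' := ⟨b, h1.choose_spec⟩
      rw [dif_pos h2]
      exact congrArg some (hf _ _ _ h2.choose_spec h1.choose_spec)
    · intro h
      split_ifs at h with h1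
      obtain rfl : h1.choose = b := by simpa using h
      have h2 : ∃ a', R a' h1.choose := ⟨a, h1.choose_spec⟩
      rw [dif_pos h2]
      exact congrArg some (hi _ _ _ h2.choose_spec h1.choose_spec)

theorem mem_ofRel {R : X → X → Prop} {hf : ∀ a b c, R a b → R a c → b = c}
    {hi : ∀ a b c, R a c → R b c → a = b} {a b : X} : b ∈ ofRel R hf hi a ↔ R a b := by
  classical
  have : ofRel R hf hi a = if h : ∃ b, R a b then some h.choose else none := rfl
  rw [this]
  split_ifs with h
  · constructor
    · intro hb
      obtain rfl : h.choose = b := by simpa using hb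
      exact h.choose_spec
    · intro hb
      exact congrArg some (hf _ _ _ h.choose_spec hb)
  · constructor
    · intro hb
      simp at hb
    · intro hb
      exact absurd ⟨b, hb⟩ h

end PartialBijections

/-! ### Filters of idempotents, ultrafilters, tight filters -/

section Filters

variable {X : Type*}

/-- A semigroup of partial bijections that is closed under inverses, i.e. an inverse semigroup. -/
class InverseClosed (S : Subsemigroup (X ≃. X)) : Prop where
  symm_mem : ∀ s ∈ S, s.symm ∈ S

/-- The set of idempotents of `S`. -/
def idempotents (S : Subsemigroup (X ≃. X)) : Set (X ≃. X) := {e | e ∈ S ∧ e * e = e}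

/-- The (proper) filters of idempotents of `S`. The zero element is the empty map. -/
@[ext] structure EFilter (S : Subsemigroup (X ≃. X)) where
  carrier : Set (X ≃. X)
  subset : carrier ⊆ idempotents S
  nonempty : carrier.Nonempty
  zero_notMem : ⊥ ∉ carrier
  up : ∀ e ∈ carrier, ∀ f ∈ idempotents S, e = e * f → f ∈ carrier
  mul_mem : ∀ e ∈ carrier, ∀ f ∈ carrier, e * f ∈ carrier

/-- The set `𝓤(A, B)` of the filters that contain `A` and avoid `B`. -/
def basicOpen (S : Subsemigroup (X ≃. X)) (A B : Set (X ≃. X)) : Set (EFilter S) :=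
  {η | A ⊆ η.carrier ∧ B ∩ η.carrier = ∅}

/-- The topology on filters generated by the sets `𝓤(A, B)` with `A`, `B` finite sets of
idempotents. -/
instance (S : Subsemigroup (X ≃. X)) : TopologicalSpace (EFilter S) :=
  TopologicalSpace.generateFrom
    {U | ∃ A B : Set (X ≃. X), A.Finite ∧ B.Finite ∧ A ⊆ idempotents S ∧ B ⊆ idempotents S ∧
      U = basicOpen S A B}

/-- An ultrafilter is a filter that is not properly contained in another one. -/
def ultrafilters (S : Subsemigroup (X ≃. X)) : Set (EFilter S) :=
  {η | ∀ ζ : EFilter S, η.carrier ⊆ ζ.carrier → ζ = η}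

/-- The space of tight filters: the closure of the set of ultrafilters in the space of filters,
with the subspace topology. -/
abbrev TightFilter (S : Subsemigroup (X ≃. X)) : Type _ :=
  {η : EFilter S // η ∈ closure (ultrafilters S)}

variable {S : Subsemigroup (X ≃. X)}

theorem EFilter.idem (η : EFilter S) {e : X ≃. X} (he : e ∈ η.carrier) {a b : X} (h : b ∈ e a) :
    b = a := idem_iff.1 (η.subset he).2 _ _ h

theorem idempotents_mul {e f : X ≃. X} (he : e ∈ idempotents S) (hf : f ∈ idempotents S) :
    e * f ∈ idempotents S := by
  refine ⟨S.mul_mem he.1 hf.1, idem_iff.2 fun a b h => ?_⟩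
  obtain ⟨c, hc, hb⟩ := mem_mul.1 h
  rw [idem_iff.1 he.2 _ _ hb, idem_iff.1 hf.2 _ _ hc]

/-- Upward closure, in terms of domains. -/
theorem EFilter.up' (η : EFilter S) {e f : X ≃. X} (he : e ∈ η.carrier)
    (hf : f ∈ idempotents S) (h : ∀ a, a ∈ e a → a ∈ f a) : f ∈ η.carrier := by
  refine η.up e he f hf (pext fun a b => ?_)
  rw [mem_mul]
  constructor
  · intro hb
    obtain rfl := η.idem he hb
    exact ⟨b, h _ hb, hb⟩
  · rintro ⟨c, hc, hb⟩
    obtain rfl := idem_iff.1 hf.2 _ _ hc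
    exact hb

theorem EFilter.ext' {η ζ : EFilter S}
    (h : ∀ f ∈ idempotents S, f ∈ η.carrier ↔ f ∈ ζ.carrier) : η = ζ := by
  ext f
  exact ⟨fun hf => (h f (η.subset hf)).1 hf, fun hf => (h f (ζ.subset hf)).2 hf⟩

theorem isTopologicalBasis_basicOpen :
    TopologicalSpace.IsTopologicalBasis
      {U : Set (EFilter S) | ∃ A B : Set (X ≃. X), A.Finite ∧ B.Finite ∧ A ⊆ idempotents S ∧
        B ⊆ idempotents S ∧ U = basicOpen S A B} where
  exists_subset_inter := by
    rintro _ ⟨A, B, h1, h2, h3, h4, rfl⟩ _ ⟨A', B', h1', h2', h3', h4', rfl⟩ η hη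
    refine ⟨basicOpen S (A ∪ A') (B ∪ B'), ⟨_, _, h1.union h1', h2.union h2',
      Set.union_subset h3 h3', Set.union_subset h4 h4', rfl⟩, ?_, ?_⟩
    · refine ⟨Set.union_subset hη.1.1 hη.2.1, ?_⟩
      rw [Set.union_inter_distrib_right, hη.1.2, hη.2.2, Set.union_empty]
    · rintro ζ ⟨hA, hB⟩
      rw [Set.union_inter_distrib_right, Set.union_empty_iff] at hB
      rw [Set.union_subset_iff] at hA
      exact ⟨⟨hA.1, hB.1⟩, hA.2, hB.2⟩
  sUnion_eq := by
    refine Set.eq_univ_of_forall fun η => Set.mem_sUnion.2 ⟨basicOpen S ∅ ∅, ⟨∅, ∅,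
      Set.finite_empty, Set.finite_empty, Set.empty_subset _, Set.empty_subset _, rfl⟩, ?_⟩
    exact ⟨Set.empty_subset _, Set.empty_inter _⟩
  eq_generateFrom := rfl

theorem mem_closure_basicOpen {η : EFilter S} {P : Set (EFilter S)} :
    η ∈ closure P ↔ ∀ A B : Set (X ≃. X), A.Finite → B.Finite → A ⊆ idempotents S →
      B ⊆ idempotents S → η ∈ basicOpen S A B → ∃ ζ ∈ P, ζ ∈ basicOpen S A B := by
  rw [isTopologicalBasis_basicOpen.mem_closure_iff]
  constructor
  · intro h A B h1 h2 h3 h4 h5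
    obtain ⟨ζ, hζ, hP⟩ := h _ ⟨A, B, h1, h2, h3, h4, rfl⟩ h5
    exact ⟨ζ, hP, hζ⟩
  · rintro h _ ⟨A, B, h1, h2, h3, h4, rfl⟩ h5
    obtain ⟨ζ, hP, hζ⟩ := h A B h1 h2 h3 h4 h5
    exact ⟨ζ, hζ, hP⟩

/-- If an idempotent of an ultrafilter is covered by finitely many idempotents, then one of them
belongs to the ultrafilter. -/
theorem exists_mem_of_cover_ultra {η : EFilter S} (hη : η ∈ ultrafilters S) {e : X ≃. X}
    (he : e ∈ η.carrier) {F : Set (X ≃. X)} (hF : F.Finite) (hF' : F ⊆ idempotents S)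
    (hcov : ∀ a, a ∈ e a → ∃ f ∈ F, a ∈ f a) : ∃ f ∈ F, f ∈ η.carrier := by
  by_contra hcon
  push Not at hcon
  have h1 : ∀ f ∈ F, ∃ g ∈ η.carrier, ∀ a, a ∈ g a → a ∉ f a := by
    intro f hf
    by_contra hne
    push Not at hne
    have hmeet : ∀ g ∈ η.carrier, ∃ a, a ∈ (g * f) a := fun g hg => by
      obtain ⟨a, ha, ha'⟩ := hne g hg
      exact ⟨a, mem_mul.2 ⟨a, ha', ha⟩⟩
    obtain ⟨g0, hg0⟩ := η.nonempty
    have hsplit : ∀ {g a}, g ∈ η.carrier → a ∈ (g * f) a → a ∈ g a ∧ a ∈ f a := by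
      intro g a hg ha
      obtain ⟨b, hb, hb'⟩ := mem_mul.1 ha
      obtain rfl := idem_iff.1 (hF' hf).2 _ _ hb
      exact ⟨hb', hb⟩
    let ζ : EFilter S :=
      { carrier := {u | u ∈ idempotents S ∧ ∃ g ∈ η.carrier, ∀ a, a ∈ (g * f) a → a ∈ u a}
        subset := fun u hu => hu.1
        nonempty := ⟨f, hF' hf, g0, hg0, fun a ha => (hsplit hg0 ha).2⟩
        zero_notMem := by
          rintro ⟨-, g, hg, h⟩
          obtain ⟨a, ha⟩ := hmeet g hg
          have := h a ha
          simp at this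
        up := by
          rintro u ⟨hu, g, hg, h⟩ v hv huv
          refine ⟨hv, g, hg, fun a ha => ?_⟩
          have h2 := h a ha
          rw [huv] at h2
          obtain ⟨b, hb, -⟩ := mem_mul.1 h2
          obtain rfl := idem_iff.1 hv.2 _ _ hb
          exact hb
        mul_mem := by
          rintro u ⟨hu, g, hg, h⟩ v ⟨hv, g', hg', h'⟩
          refine ⟨idempotents_mul hu hv, g * g', η.mul_mem _ hg _ hg', fun a ha => ?_⟩
          obtain ⟨h2, h3⟩ := hsplit (η.mul_mem _ hg _ hg') ha
          obtain ⟨b, hb, hb'⟩ := mem_mul.1 h2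
          obtain rfl := η.idem hg' hb
          exact mem_mul.2 ⟨b, h' b (mem_mul.2 ⟨b, h3, hb⟩), h b (mem_mul.2 ⟨b, h3, hb'⟩)⟩ }
    have h2 : ζ = η := hη ζ fun u hu =>
      ⟨η.subset hu, u, hu, fun a ha => (hsplit hu ha).1⟩
    refine hcon f hf ?_
    rw [← h2]
    exact ⟨hF' hf, g0, hg0, fun a ha => (hsplit hg0 ha).2⟩
  have h2 : ∃ g ∈ η.carrier, ∀ f ∈ F, ∀ a, a ∈ g a → a ∉ f a := by
    clear hcon hcov
    induction F, hF using Set.Finite.induction_on with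
    | empty => exact ⟨e, he, by simp⟩
    | @insert f F _ _ ih =>
      obtain ⟨g, hg, h⟩ := ih (fun u hu => hF' (Set.mem_insert_of_mem _ hu))
        (fun u hu => h1 u (Set.mem_insert_of_mem _ hu))
      obtain ⟨g', hg', h'⟩ := h1 f (Set.mem_insert _ _)
      refine ⟨g * g', η.mul_mem _ hg _ hg', fun u hu a ha => ?_⟩
      obtain ⟨b, hb, hb'⟩ := mem_mul.1 ha
      obtain rfl := η.idem hg' hb
      rcases hu with rfl | hu
      · exact h' _ hb
      · exact h u hu _ hb'
  obtain ⟨g, hg, h⟩ := h2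
  refine η.zero_notMem ?_
  convert η.mul_mem _ hg _ he
  refine pext fun a b => ?_
  simp only [PEquiv.bot_apply, Option.mem_def, reduceCtorEq, false_iff]
  intro hab
  obtain ⟨c, hc, hb⟩ := mem_mul.1 hab
  obtain rfl := η.idem he hc
  obtain rfl := η.idem hg hb
  obtain ⟨f, hf, hf'⟩ := hcov _ hc
  exact h f hf _ hb hf'

/-- The same property for tight filters. -/
theorem exists_mem_of_cover {η : EFilter S} (hη : η ∈ closure (ultrafilters S)) {e : X ≃. X}
    (he : e ∈ η.carrier) {F : Set (X ≃. X)} (hF : F.Finite) (hF' : F ⊆ idempotents S)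
    (hcov : ∀ a, a ∈ e a → ∃ f ∈ F, a ∈ f a) : ∃ f ∈ F, f ∈ η.carrier := by
  by_contra hcon
  push Not at hcon
  obtain ⟨ζ, hζ, h1, h2⟩ := mem_closure_basicOpen.1 hη {e} F (Set.finite_singleton e) hF
    (Set.singleton_subset_iff.2 (η.subset he)) hF'
    ⟨Set.singleton_subset_iff.2 he, Set.eq_empty_of_forall_notMem fun f hf => hcon f hf.1 hf.2⟩
  obtain ⟨f, hf, hf'⟩ := exists_mem_of_cover_ultra hζ (h1 rfl) hF hF' hcov
  exact Set.eq_empty_iff_forall_notMem.1 h2 f ⟨hf, hf'⟩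

theorem mem_conj {s f : X ≃. X} (hf : f ∈ idempotents S) {a b : X} :
    b ∈ (s.symm * f * s) a ↔ b = a ∧ ∃ c, c ∈ s a ∧ c ∈ f c := by
  rw [mem_mul]
  constructor
  · rintro ⟨c, hc, h⟩
    obtain ⟨d, hd, h'⟩ := mem_mul.1 h
    obtain rfl := idem_iff.1 hf.2 _ _ hd
    exact ⟨mem_inj (mem_symm.1 h') hc, _, hc, hd⟩
  · rintro ⟨rfl, c, hc, hf⟩
    exact ⟨c, hc, mem_mul.2 ⟨c, hf, mem_symm.2 hc⟩⟩

theorem mem_dom {s : X ≃. X} {a b : X} :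
    b ∈ (s.symm * s) a ↔ b = a ∧ ∃ c, c ∈ s a := by
  rw [mem_mul]
  constructor
  · rintro ⟨c, hc, h⟩
    exact ⟨mem_inj (mem_symm.1 h) hc, _, hc⟩
  · rintro ⟨rfl, c, hc⟩
    exact ⟨c, hc, mem_symm.2 hc⟩

variable [InverseClosed S]

theorem conj_mem {s f : X ≃. X} (hs : s ∈ S) (hf : f ∈ idempotents S) :
    s.symm * f * s ∈ idempotents S := by
  refine ⟨S.mul_mem (S.mul_mem (InverseClosed.symm_mem s hs) hf.1) hs,
    idem_iff.2 fun a b h => ?_⟩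
  obtain ⟨c, hc, h⟩ := mem_mul.1 h
  obtain ⟨d, hd, h'⟩ := mem_mul.1 h
  obtain rfl := idem_iff.1 hf.2 _ _ hd
  exact mem_inj (mem_symm.1 h') hc

theorem conj_mem' {s f : X ≃. X} (hs : s ∈ S) (hf : f ∈ idempotents S) :
    s * f * s.symm ∈ idempotents S := by
  have := conj_mem (S := S) (s := s.symm) (InverseClosed.symm_mem s hs) hf
  rwa [PEquiv.symm_symm] at this

theorem dom_mem {s : X ≃. X} (hs : s ∈ S) : s.symm * s ∈ idempotents S := by
  refine ⟨S.mul_mem (InverseClosed.symm_mem s hs) hs, idem_iff.2 fun a b h => ?_⟩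
  obtain ⟨c, hc, h⟩ := mem_mul.1 h
  exact mem_inj (mem_symm.1 h) hc

/-- The defining condition of `s · η` can be read off from conjugates. -/
theorem act_iff (η : EFilter S) {s f : X ≃. X} (hs : s ∈ S) (hd : s.symm * s ∈ η.carrier)
    (hf : f ∈ idempotents S) :
    (∃ e ∈ η.carrier, s * e * s.symm = s * e * s.symm * f) ↔ s.symm * f * s ∈ η.carrier := by
  constructor
  · rintro ⟨e, he, h⟩
    refine η.up' (η.mul_mem _ he _ hd) (conj_mem hs hf) fun a ha => ?_
    obtain ⟨b, hb, ha⟩ := mem_mul.1 ha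
    obtain ⟨rfl, c, hc⟩ := mem_dom.1 hb
    refine (mem_conj hf).2 ⟨rfl, c, hc, ?_⟩
    have h1 : c ∈ (s * e * s.symm) c :=
      mem_mul.2 ⟨b, mem_symm.2 hc, mem_mul.2 ⟨b, ha, hc⟩⟩
    rw [h] at h1
    obtain ⟨d, hd, -⟩ := mem_mul.1 h1
    obtain rfl := idem_iff.1 hf.2 _ _ hd
    exact hd
  · intro h
    refine ⟨_, h, pext fun a b => ?_⟩
    rw [mem_mul (f := s * (s.symm * f * s) * s.symm)]
    constructor
    · intro hb
      refine ⟨a, ?_, hb⟩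
      obtain ⟨c, hc, h1⟩ := mem_mul.1 hb
      obtain ⟨d, hd, h2⟩ := mem_mul.1 h1
      obtain ⟨rfl, u, hu, hfu⟩ := (mem_conj hf).1 hd
      obtain rfl := mem_fun (mem_symm.1 hc) hu
      exact hfu
    · rintro ⟨c, hc, hb⟩
      obtain rfl := idem_iff.1 hf.2 _ _ hc
      exact hb

/-- The filter `s · η = {f | s e s* ≤ f for some e ∈ η}`, defined when `s* s ∈ η`. -/
def EFilter.act (s : X ≃. X) (hs : s ∈ S) (η : EFilter S) (hd : s.symm * s ∈ η.carrier) :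
    EFilter S where
  carrier := {f | f ∈ idempotents S ∧ ∃ e ∈ η.carrier, s * e * s.symm = s * e * s.symm * f}
  subset f hf := hf.1
  nonempty := by
    refine ⟨_, conj_mem' hs (η.subset hd), (act_iff η hs hd (conj_mem' hs (η.subset hd))).2 ?_⟩
    refine η.up' hd (conj_mem hs (conj_mem' hs (η.subset hd))) fun a ha => ?_
    obtain ⟨-, c, hc⟩ := mem_dom.1 ha
    refine (mem_conj (conj_mem' hs (η.subset hd))).2 ⟨rfl, c, hc, ?_⟩
    exact mem_mul.2 ⟨a, mem_symm.2 hc, mem_mul.2 ⟨a, ha, hc⟩⟩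
  zero_notMem := by
    rintro ⟨h1, h2⟩
    rw [act_iff η hs hd h1] at h2
    refine η.zero_notMem ?_
    convert h2
    refine pext fun a b => ?_
    rw [mem_conj h1]
    simp
  up := by
    rintro e ⟨he, he'⟩ f hf h
    refine ⟨hf, ?_⟩
    obtain ⟨g, hg, h'⟩ := he'
    exact ⟨g, hg, by rw [h', mul_assoc _ e f, ← h]⟩
  mul_mem := by
    rintro e ⟨he, he'⟩ f ⟨hf, hf'⟩
    refine ⟨idempotents_mul he hf, ?_⟩
    rw [act_iff η hs hd he] at he'
    rw [act_iff η hs hd hf] at hf'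
    rw [act_iff η hs hd (idempotents_mul he hf)]
    refine η.up' (η.mul_mem _ he' _ hf') (conj_mem hs (idempotents_mul he hf)) fun a ha => ?_
    obtain ⟨b, hb, ha⟩ := mem_mul.1 ha
    obtain ⟨rfl, c, hc, hfc⟩ := (mem_conj hf).1 hb
    obtain ⟨-, d, hd, hed⟩ := (mem_conj he).1 ha
    obtain rfl := mem_fun hc hd
    exact (mem_conj (idempotents_mul he hf)).2 ⟨rfl, c, hc, mem_mul.2 ⟨c, hfc, hed⟩⟩

theorem EFilter.mem_act {s : X ≃. X} {hs : s ∈ S} {η : EFilter S}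
    {hd : s.symm * s ∈ η.carrier} {f : X ≃. X} :
    f ∈ (η.act s hs hd).carrier ↔ f ∈ idempotents S ∧ s.symm * f * s ∈ η.carrier := by
  constructor
  · rintro ⟨h1, h2⟩
    exact ⟨h1, (act_iff η hs hd h1).1 h2⟩
  · rintro ⟨h1, h2⟩
    exact ⟨h1, (act_iff η hs hd h1).2 h2⟩

/-- `(s t) · η = s · (t · η)`, and the two sides have the same domain. -/
theorem EFilter.dom_mul {s t : X ≃. X} (hs : s ∈ S) (ht : t ∈ S) {η : EFilter S}
    (hd : t.symm * t ∈ η.carrier) :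
    (s * t).symm * (s * t) ∈ η.carrier ↔ s.symm * s ∈ (η.act t ht hd).carrier := by
  rw [EFilter.mem_act, symm_mul]
  have : t.symm * s.symm * (s * t) = t.symm * (s.symm * s) * t := by simp only [mul_assoc]
  rw [this]
  exact ⟨fun h => ⟨dom_mem hs, h⟩, fun h => h.2⟩

theorem EFilter.dom_of_dom_mul {s t : X ≃. X} (ht : t ∈ S) {η : EFilter S}
    (h : (s * t).symm * (s * t) ∈ η.carrier) : t.symm * t ∈ η.carrier := by
  refine η.up' h (dom_mem ht) fun a ha => ?_
  obtain ⟨-, c, hc⟩ := mem_dom.1 ha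
  obtain ⟨b, hb, -⟩ := mem_mul.1 hc
  exact mem_dom.2 ⟨rfl, b, hb⟩

theorem EFilter.act_mul {s t : X ≃. X} (hs : s ∈ S) (ht : t ∈ S) {η : EFilter S}
    (hd : t.symm * t ∈ η.carrier) (hd' : s.symm * s ∈ (η.act t ht hd).carrier)
    (hd'' : (s * t).symm * (s * t) ∈ η.carrier) :
    η.act (s * t) (S.mul_mem hs ht) hd'' = (η.act t ht hd).act s hs hd' := by
  refine EFilter.ext' fun f hf => ?_
  simp only [EFilter.mem_act, hf, conj_mem hs hf, true_and]
  rw [symm_mul]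
  simp only [mul_assoc]

/-- If `s` and `t` agree on some `e ∈ η`, then `s · η = t · η`. -/
theorem EFilter.act_congr {s t e : X ≃. X} (hs : s ∈ S) (ht : t ∈ S) {η : EFilter S}
    (hd : s.symm * s ∈ η.carrier) (hd' : t.symm * t ∈ η.carrier) (he : e ∈ η.carrier)
    (h : s * e = t * e) : η.act s hs hd = η.act t ht hd' := by
  have key : ∀ {s t : X ≃. X} (hs : s ∈ S) (ht : t ∈ S) (hd : s.symm * s ∈ η.carrier)
      (hd' : t.symm * t ∈ η.carrier), s * e = t * e →
      ∀ f ∈ (η.act s hs hd).carrier, f ∈ (η.act t ht hd').carrier := by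
    intro s t hs ht hd hd' h f hf
    rw [EFilter.mem_act] at hf ⊢
    refine ⟨hf.1, η.up' (η.mul_mem _ hf.2 _ he) (conj_mem ht hf.1) fun a ha => ?_⟩
    obtain ⟨b, hb, ha⟩ := mem_mul.1 ha
    obtain rfl := η.idem he hb
    obtain ⟨-, c, hc, hfc⟩ := (mem_conj hf.1).1 ha
    refine (mem_conj hf.1).2 ⟨rfl, c, ?_, hfc⟩
    have h1 : c ∈ (s * e) b := mem_mul.2 ⟨b, hb, hc⟩
    rw [h] at h1
    obtain ⟨d, hd, hc'⟩ := mem_mul.1 h1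
    obtain rfl := η.idem he hd
    exact hc'
  exact EFilter.ext' fun f _ => ⟨key hs ht hd hd' h f, key ht hs hd' hd h.symm f⟩

/-- An idempotent acts as the identity on the filters that contain it. -/
theorem EFilter.act_idem {e : X ≃. X} (he : e ∈ idempotents S) {η : EFilter S}
    (hd : e.symm * e ∈ η.carrier) : η.act e he.1 hd = η := by
  refine EFilter.ext' fun f hf => ?_
  rw [EFilter.mem_act]
  constructor
  · rintro ⟨-, h⟩
    refine η.up' h hf fun a ha => ?_
    obtain ⟨-, c, hc, hfc⟩ := (mem_conj hf).1 ha
    obtain rfl := idem_iff.1 he.2 _ _ hc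
    exact hfc
  · intro h
    refine ⟨hf, η.up' (η.mul_mem _ h _ hd) (conj_mem he.1 hf) fun a ha => ?_⟩
    obtain ⟨b, hb, ha⟩ := mem_mul.1 ha
    obtain ⟨rfl, c, hc⟩ := mem_dom.1 hb
    obtain rfl := idem_iff.1 he.2 _ _ hc
    exact (mem_conj hf).2 ⟨rfl, c, hc, ha⟩

theorem EFilter.dom_symm {s : X ≃. X} {hs : s ∈ S} {η : EFilter S}
    {hd : s.symm * s ∈ η.carrier} :
    s.symm.symm * s.symm ∈ (η.act s hs hd).carrier := by
  have h1 : s.symm.symm * s.symm ∈ idempotents S := dom_mem (InverseClosed.symm_mem s hs)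
  rw [EFilter.mem_act]
  refine ⟨h1, η.up' hd (conj_mem hs h1) fun a ha => ?_⟩
  obtain ⟨-, c, hc⟩ := mem_dom.1 ha
  exact (mem_conj h1).2 ⟨rfl, c, hc, mem_dom.2 ⟨rfl, a, mem_symm.2 hc⟩⟩

theorem EFilter.act_symm {s : X ≃. X} (hs : s ∈ S) {η : EFilter S}
    (hd : s.symm * s ∈ η.carrier) (hd' : s.symm.symm * s.symm ∈ (η.act s hs hd).carrier) :
    (η.act s hs hd).act s.symm (InverseClosed.symm_mem s hs) hd' = η := by
  have h0 := InverseClosed.symm_mem s hs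
  have h1 : (s.symm * s).symm * (s.symm * s) ∈ η.carrier := (EFilter.dom_mul h0 hs hd).2 hd'
  rw [← EFilter.act_mul h0 hs hd hd' h1]
  exact EFilter.act_idem (dom_mem hs) h1

theorem EFilter.act_ultra {s : X ≃. X} (hs : s ∈ S) {η : EFilter S}
    (hd : s.symm * s ∈ η.carrier) (hη : η ∈ ultrafilters S) :
    η.act s hs hd ∈ ultrafilters S := by
  intro ζ hζ
  have h0 := InverseClosed.symm_mem s hs
  have hd' : s.symm.symm * s.symm ∈ ζ.carrier := hζ EFilter.dom_symm
  have h1 : ζ.act s.symm h0 hd' = η := by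
    refine hη _ fun f hf => ?_
    rw [← EFilter.act_symm hs hd EFilter.dom_symm, EFilter.mem_act] at hf
    exact EFilter.mem_act.2 ⟨hf.1, hζ hf.2⟩
  have h2 := EFilter.act_symm h0 hd' EFilter.dom_symm
  rw [← h2]
  congr 1

theorem EFilter.act_tight {s : X ≃. X} (hs : s ∈ S) {η : EFilter S}
    (hd : s.symm * s ∈ η.carrier) (hη : η ∈ closure (ultrafilters S)) :
    η.act s hs hd ∈ closure (ultrafilters S) := by
  rw [mem_closure_basicOpen]
  rintro A B hA hB hA' hB' ⟨h1, h2⟩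
  obtain ⟨ζ, hζ, h3, h4⟩ := mem_closure_basicOpen.1 hη
    (insert (s.symm * s) ((fun f => s.symm * f * s) '' A)) ((fun f => s.symm * f * s) '' B)
    ((hA.image _).insert _) (hB.image _)
    (by
      rintro _ (rfl | ⟨f, hf, rfl⟩)
      · exact dom_mem hs
      · exact conj_mem hs (hA' hf))
    (by
      rintro _ ⟨f, hf, rfl⟩
      exact conj_mem hs (hB' hf))
    ⟨by
      rintro _ (rfl | ⟨f, hf, rfl⟩)
      · exact hd
      · exact (EFilter.mem_act.1 (h1 hf)).2, by
      refine Set.eq_empty_of_forall_notMem ?_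
      rintro _ ⟨⟨f, hf, rfl⟩, h⟩
      exact Set.eq_empty_iff_forall_notMem.1 h2 f ⟨hf, EFilter.mem_act.2 ⟨hB' hf, h⟩⟩⟩
  refine ⟨ζ.act s hs (h3 (Set.mem_insert _ _)), EFilter.act_ultra hs _ hζ, fun f hf => ?_, ?_⟩
  · exact EFilter.mem_act.2 ⟨hA' hf, h3 (Set.mem_insert_of_mem _ ⟨f, hf, rfl⟩)⟩
  · refine Set.eq_empty_of_forall_notMem ?_
    rintro f ⟨hf, h⟩
    exact Set.eq_empty_iff_forall_notMem.1 h4 _ ⟨⟨f, hf, rfl⟩, (EFilter.mem_act.1 h).2⟩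

/-- The action of `s ∈ S` on the tight filters that contain `s* s`. -/
def TightFilter.act (s : X ≃. X) (hs : s ∈ S) (ξ : TightFilter S)
    (hd : s.symm * s ∈ ξ.1.carrier) : TightFilter S :=
  ⟨ξ.1.act s hs hd, EFilter.act_tight hs hd ξ.2⟩

end Filters

/-! ### Topological groupoids -/

section Groupoids

/-- A groupoid with unit space `X` and set of arrows `G`. The product `a b` is defined when
`src a = rng b`. -/
structure GroupoidOn (X G : Type*) where
  src : G → X
  rng : G → X
  unit : X → G
  mul : (a b : G) → src a = rng b → G
  inv : G → G
  src_mul : ∀ a b h, src (mul a b h) = src b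
  rng_mul : ∀ a b h, rng (mul a b h) = rng a
  src_unit : ∀ x, src (unit x) = x
  rng_unit : ∀ x, rng (unit x) = x
  src_inv : ∀ a, src (inv a) = rng a
  rng_inv : ∀ a, rng (inv a) = src a
  mul_assoc : ∀ a b c (h : src a = rng b) (h' : src b = rng c),
    mul (mul a b h) c ((src_mul a b h).trans h') = mul a (mul b c h') (h.trans (rng_mul b c h').symm)
  unit_mul : ∀ a, mul (unit (rng a)) a (src_unit _) = a
  mul_unit : ∀ a, mul a (unit (src a)) (rng_unit _).symm = a
  inv_mul : ∀ a, mul (inv a) a (src_inv a) = unit (src a)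
  mul_inv : ∀ a, mul a (inv a) (rng_inv a).symm = unit (rng a)

variable {X G Y H : Type*}

/-- All the structure maps of the groupoid are continuous; the set of composable pairs has the
topology induced from `G × G`. -/
structure GroupoidOn.IsTopological [TopologicalSpace X] [TopologicalSpace G]
    (𝓖 : GroupoidOn X G) : Prop where
  continuous_src : Continuous 𝓖.src
  continuous_rng : Continuous 𝓖.rng
  continuous_unit : Continuous 𝓖.unit
  continuous_inv : Continuous 𝓖.inv
  continuous_mul :
    Continuous fun p : {p : G × G // 𝓖.src p.1 = 𝓖.rng p.2} => 𝓖.mul p.1.1 p.1.2 p.2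

/-- An isomorphism of topological groupoids: a homeomorphism of the spaces of arrows and a
homeomorphism of the unit spaces that respect the groupoid operations. -/
structure TopGroupoidIso [TopologicalSpace X] [TopologicalSpace G] [TopologicalSpace Y]
    [TopologicalSpace H] (𝓖 : GroupoidOn X G) (𝓗 : GroupoidOn Y H) where
  arrows : G ≃ₜ H
  units : X ≃ₜ Y
  map_src : ∀ a, 𝓗.src (arrows a) = units (𝓖.src a)
  map_rng : ∀ a, 𝓗.rng (arrows a) = units (𝓖.rng a)
  map_unit : ∀ x, arrows (𝓖.unit x) = 𝓗.unit (units x)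
  map_inv : ∀ a, arrows (𝓖.inv a) = 𝓗.inv (arrows a)
  map_mul : ∀ a b (h : 𝓖.src a = 𝓖.rng b), arrows (𝓖.mul a b h) =
    𝓗.mul (arrows a) (arrows b)
      ((map_src a).trans ((congrArg units h).trans (map_rng b).symm))

/-- A continuous `Q`-valued cocycle: a groupoid homomorphism to the discrete group `Q`. -/
structure GroupoidOn.IsCocycle [TopologicalSpace G] {Q : Type*} [Group Q] (𝓖 : GroupoidOn X G)
    (c : G → Q) : Prop where
  map_mul : ∀ a b h, c (𝓖.mul a b h) = c a * c b
  locallyConstant : IsLocallyConstant c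

end Groupoids

/-! ### The tight groupoid of an inverse semigroup of partial bijections -/

section TightGroupoid

variable {X : Type*}

/-- The pairs `(s, ξ)` with `s ∈ S` and `ξ` a tight filter in the domain of `s`. -/
structure PreGerm (S : Subsemigroup (X ≃. X)) where
  elt : X ≃. X
  elt_mem : elt ∈ S
  pt : TightFilter S
  dom : elt.symm * elt ∈ pt.1.carrier

/-- `(s, ξ) ∼ (t, ξ')` if `ξ = ξ'` and `s e = t e` for some idempotent `e ∈ ξ`. -/
instance germSetoid (S : Subsemigroup (X ≃. X)) : Setoid (PreGerm S) where
  r p q := p.pt = q.pt ∧ ∃ e ∈ p.pt.1.carrier, p.elt * e = q.elt * e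
  iseqv :=
    { refl := fun p => ⟨rfl, _, p.dom, rfl⟩
      symm := by
        rintro p q ⟨h, e, he, h'⟩
        exact ⟨h.symm, e, h ▸ he, h'.symm⟩
      trans := by
        rintro p q r ⟨h, e, he, h'⟩ ⟨k, f, hf, k'⟩
        refine ⟨h.trans k, e * f, p.pt.1.mul_mem _ he _ (h ▸ hf), ?_⟩
        have hc : e * f = f * e := by
          refine pext fun a b => ?_
          have key : ∀ {e f : X ≃. X}, e ∈ p.pt.1.carrier → f ∈ p.pt.1.carrier →
              b ∈ (e * f) a → b ∈ (f * e) a := by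
            intro e f he hf hb
            obtain ⟨c, hc, hb'⟩ := mem_mul.1 hb
            obtain rfl := p.pt.1.idem hf hc
            obtain rfl := p.pt.1.idem he hb'
            exact mem_mul.2 ⟨_, hb', hc⟩
          exact ⟨key he (h ▸ hf), key (h ▸ hf) he⟩
        calc p.elt * (e * f) = q.elt * (e * f) := by rw [← mul_assoc, h', mul_assoc]
          _ = r.elt * (e * f) := by rw [hc, ← mul_assoc, k', mul_assoc] }

/-- The set of arrows of the tight groupoid: the germs `[s, ξ]`. -/
def TightGerm (S : Subsemigroup (X ≃. X)) : Type _ := Quotient (germSetoid S)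

variable {S : Subsemigroup (X ≃. X)}

/-- The germ `[s, ξ]`. -/
def TightGerm.mk (s : X ≃. X) (hs : s ∈ S) (ξ : TightFilter S)
    (hd : s.symm * s ∈ ξ.1.carrier) : TightGerm S := Quotient.mk _ ⟨s, hs, ξ, hd⟩

/-- The set `Θ(s, U) = {[s, ξ] | ξ ∈ U}`. -/
def TightGerm.basic (s : X ≃. X) (hs : s ∈ S) (U : Set (TightFilter S)) : Set (TightGerm S) :=
  {a | ∃ ξ ∈ U, ∃ hd : s.symm * s ∈ ξ.1.carrier, a = TightGerm.mk s hs ξ hd}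

/-- The topology generated by the sets `Θ(s, U)`, with `s ∈ S` and `U` an open set of tight
filters that is contained in the domain of `s`. -/
instance (S : Subsemigroup (X ≃. X)) : TopologicalSpace (TightGerm S) :=
  TopologicalSpace.generateFrom
    {V | ∃ (s : X ≃. X) (hs : s ∈ S) (U : Set (TightFilter S)), IsOpen U ∧
      (∀ ξ ∈ U, s.symm * s ∈ ξ.1.carrier) ∧ V = TightGerm.basic s hs U}

theorem TightGerm.ind {P : TightGerm S → Prop}
    (h : ∀ s hs ξ hd, P (TightGerm.mk s hs ξ hd)) (a : TightGerm S) : P a := by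
  induction a using Quotient.inductionOn with
  | h p => exact h p.elt p.elt_mem p.pt p.dom

theorem TightGerm.mk_eq {s t : X ≃. X} {hs : s ∈ S} {ht : t ∈ S} {ξ ζ : TightFilter S}
    {hd : s.symm * s ∈ ξ.1.carrier} {hd' : t.symm * t ∈ ζ.1.carrier} :
    TightGerm.mk s hs ξ hd = TightGerm.mk t ht ζ hd' ↔
      ξ = ζ ∧ ∃ e ∈ ξ.1.carrier, s * e = t * e := Quotient.eq

/-- `d([s, ξ]) = ξ`. -/
def TightGerm.src (a : TightGerm S) : TightFilter S :=
  Quotient.lift (fun p : PreGerm S => p.pt) (fun p q (h : p.pt = q.pt ∧ _) => h.1) a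

theorem src_mk {s : X ≃. X} {hs : s ∈ S} {ξ : TightFilter S}
    {hd : s.symm * s ∈ ξ.1.carrier} : (TightGerm.mk s hs ξ hd).src = ξ := rfl

theorem germ_mk_congr {s t : X ≃. X} {hs : s ∈ S} {ht : t ∈ S} {ξ ζ : TightFilter S}
    {hd : s.symm * s ∈ ξ.1.carrier} {hd' : t.symm * t ∈ ζ.1.carrier} (h : s = t) (h' : ξ = ζ) :
    TightGerm.mk s hs ξ hd = TightGerm.mk t ht ζ hd' := by
  subst h h'
  rfl

variable [InverseClosed S]

theorem TightFilter.mem_act {s f : X ≃. X} {hs : s ∈ S} {ξ : TightFilter S}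
    {hd : s.symm * s ∈ ξ.1.carrier} :
    f ∈ (ξ.act s hs hd).1.carrier ↔ f ∈ idempotents S ∧ s.symm * f * s ∈ ξ.1.carrier :=
  EFilter.mem_act (hs := hs) (hd := hd)

/-- `r([s, ξ]) = s · ξ`. -/
def TightGerm.rng (a : TightGerm S) : TightFilter S :=
  Quotient.lift (fun p : PreGerm S => p.pt.act p.elt p.elt_mem p.dom) (by
    rintro ⟨s, hs, ξ, hd⟩ ⟨t, ht, ζ, hd'⟩ ⟨h, e, he, h'⟩
    obtain rfl : ξ = ζ := h
    exact Subtype.ext (EFilter.act_congr hs ht hd hd' he h')) a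

theorem mk_dom_mul {s t : X ≃. X} {hs : s ∈ S} {ht : t ∈ S} {ξ ζ : TightFilter S}
    {hd : s.symm * s ∈ ξ.1.carrier} {hd' : t.symm * t ∈ ζ.1.carrier}
    (h : ξ = ζ.act t ht hd') : (s * t).symm * (s * t) ∈ ζ.1.carrier := by
  subst h
  exact (EFilter.dom_mul hs ht hd').2 hd

/-- `[s, ξ] [t, ζ] = [s t, ζ]` if `ξ = t · ζ`. -/
noncomputable def TightGerm.mul (a b : TightGerm S) (h : a.src = b.rng) : TightGerm S :=
  TightGerm.mk (a.out.elt * b.out.elt) (S.mul_mem a.out.elt_mem b.out.elt_mem) b.out.pt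
    (mk_dom_mul (hs := a.out.elt_mem) (hd := a.out.dom) (hd' := b.out.dom) (by
      rw [← Quotient.out_eq a, ← Quotient.out_eq b] at h
      exact h))

/-- The product does not depend on the choice of representatives. -/
theorem TightGerm.mk_mul_mk {s t : X ≃. X} {hs : s ∈ S} {ht : t ∈ S} {ξ ζ : TightFilter S}
    {hd : s.symm * s ∈ ξ.1.carrier} {hd' : t.symm * t ∈ ζ.1.carrier}
    (h : (TightGerm.mk s hs ξ hd).src = (TightGerm.mk t ht ζ hd').rng) :
    TightGerm.mul (TightGerm.mk s hs ξ hd) (TightGerm.mk t ht ζ hd') h =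
      TightGerm.mk (s * t) (S.mul_mem hs ht) ζ (mk_dom_mul (hs := hs) (hd := hd) h) := by
  have h1 : (TightGerm.mk s hs ξ hd).out ≈ ⟨s, hs, ξ, hd⟩ := Quotient.mk_out _
  have h2 : (TightGerm.mk t ht ζ hd').out ≈ ⟨t, ht, ζ, hd'⟩ := Quotient.mk_out _
  unfold TightGerm.mul
  generalize_proofs p1 p2 p3
  revert p1 p2 p3
  generalize (TightGerm.mk s hs ξ hd).out = p at *
  generalize (TightGerm.mk t ht ζ hd').out = q at *
  intro p1 p2 p3
  obtain ⟨s', hs', ξ', hd1⟩ := p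
  obtain ⟨t', ht', ζ', hd2⟩ := q
  obtain ⟨h1, e, he, h1'⟩ := h1
  obtain ⟨h2, f, hf, h2'⟩ := h2
  dsimp only at h1 h2 he hf h1' h2' p1 p2 p3 ⊢
  subst h1 h2
  obtain rfl : ξ' = ζ'.act t ht hd' := h
  refine TightGerm.mk_eq.2 ⟨rfl, f * (t.symm * e * t), ?_, ?_⟩
  · refine ζ'.1.mul_mem _ hf _ ?_
    exact (TightFilter.mem_act.1 he).2
  · have hte : t * (t.symm * e * t) = e * t := by
      refine pext fun a b => ?_
      rw [mem_mul, mem_mul]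
      constructor
      · rintro ⟨c, hc, hb⟩
        obtain ⟨rfl, d, hd, hed⟩ := (mem_conj ((ζ'.act t ht hd').1.subset he)).1 hc
        obtain rfl := mem_fun hb hd
        exact ⟨_, hd, hed⟩
      · rintro ⟨c, hc, hb⟩
        obtain rfl := (ζ'.act t ht hd').1.idem he hb
        exact ⟨a, (mem_conj ((ζ'.act t ht hd').1.subset he)).2 ⟨rfl, _, hc, hb⟩, hc⟩
    have hcomm : f * (t.symm * e * t) = (t.symm * e * t) * f := by
      have h3 := conj_mem ht ((ζ'.act t ht hd').1.subset he)
      have h4 := ζ'.1.subset hf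
      refine pext fun a b => ?_
      rw [mem_mul, mem_mul]
      constructor
      · rintro ⟨c, hc, hb⟩
        obtain rfl := idem_iff.1 h3.2 _ _ hc
        obtain rfl := idem_iff.1 h4.2 _ _ hb
        exact ⟨_, hb, hc⟩
      · rintro ⟨c, hc, hb⟩
        obtain rfl := idem_iff.1 h4.2 _ _ hc
        obtain rfl := idem_iff.1 h3.2 _ _ hb
        exact ⟨_, hb, hc⟩
    have ht1 : t * (f * (t.symm * e * t)) = e * (t * f) := by
      rw [hcomm, ← mul_assoc, hte, mul_assoc]
    calc s' * t' * (f * (t.symm * e * t)) = s' * (t * (f * (t.symm * e * t))) := by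
          rw [mul_assoc, ← mul_assoc t', h2', mul_assoc t]
      _ = s * t * (f * (t.symm * e * t)) := by
          rw [ht1, ← mul_assoc s', h1', mul_assoc s, ← ht1, mul_assoc s]

theorem rng_mk {s : X ≃. X} {hs : s ∈ S} {ξ : TightFilter S}
    {hd : s.symm * s ∈ ξ.1.carrier} : (TightGerm.mk s hs ξ hd).rng = ξ.act s hs hd := rfl

theorem inv_dom {s : X ≃. X} (hs : s ∈ S) (ξ : TightFilter S)
    (hd : s.symm * s ∈ ξ.1.carrier) :
    s.symm.symm * s.symm ∈ (ξ.act s hs hd).1.carrier :=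
  EFilter.dom_symm (hs := hs) (hd := hd)

/-- `[s, ξ]⁻¹ = [s*, s · ξ]`. -/
def TightGerm.inv (a : TightGerm S) : TightGerm S :=
  Quotient.lift (fun p : PreGerm S => TightGerm.mk p.elt.symm
    (InverseClosed.symm_mem _ p.elt_mem) (p.pt.act p.elt p.elt_mem p.dom)
      (inv_dom p.elt_mem p.pt p.dom)) (by
    rintro ⟨s, hs, ξ, hd⟩ ⟨t, ht, ζ, hd'⟩ ⟨h, e, he, h'⟩
    obtain rfl : ξ = ζ := h
    dsimp only at he h' ⊢
    have hst : ξ.act s hs hd = ξ.act t ht hd' :=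
      Subtype.ext (EFilter.act_congr hs ht hd hd' he h')
    refine TightGerm.mk_eq.2 ⟨hst, s * e * s.symm, ?_, ?_⟩
    · refine TightFilter.mem_act.2 ⟨conj_mem' hs (ξ.1.subset he), ?_⟩
      refine ξ.1.up' (ξ.1.mul_mem _ he _ hd)
        (conj_mem hs (conj_mem' hs (ξ.1.subset he))) fun a ha => ?_
      obtain ⟨b, hb, ha⟩ := mem_mul.1 ha
      obtain ⟨rfl, c, hc⟩ := mem_dom.1 hb
      exact (mem_conj (conj_mem' hs (ξ.1.subset he))).2
        ⟨rfl, c, hc, mem_mul.2 ⟨_, mem_symm.2 hc, mem_mul.2 ⟨_, ha, hc⟩⟩⟩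
    · have h1 : ∀ a b, a ∈ e a → (b ∈ s a ↔ b ∈ t a) := by
        intro a b ha
        have h2 : b ∈ (s * e) a ↔ b ∈ (t * e) a := by rw [h']
        rw [mem_mul, mem_mul] at h2
        constructor
        · intro hb
          obtain ⟨c, hc, hb'⟩ := h2.1 ⟨a, ha, hb⟩
          obtain rfl := ξ.1.idem he hc
          exact hb'
        · intro hb
          obtain ⟨c, hc, hb'⟩ := h2.2 ⟨a, ha, hb⟩
          obtain rfl := ξ.1.idem he hc
          exact hb'
      refine pext fun a b => ?_
      rw [mem_mul, mem_mul]
      refine exists_congr fun c => and_congr_right fun hc => ?_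
      obtain ⟨d, hd, hc1⟩ := mem_mul.1 hc
      obtain ⟨d', hd', hc2⟩ := mem_mul.1 hc1
      obtain rfl := ξ.1.idem he hd'
      rw [mem_symm, mem_symm]
      have h3 := (h1 d' c hd').1 hc2
      constructor
      · intro hb
        obtain rfl := mem_inj hb hc2
        exact h3
      · intro hb
        obtain rfl := mem_inj hb h3
        exact hc2) a

theorem unit_dom {ξ : TightFilter S} {e : X ≃. X} (he : e ∈ ξ.1.carrier) :
    e.symm * e ∈ ξ.1.carrier := by
  refine ξ.1.up' he (dom_mem (ξ.1.subset he).1) fun a ha => mem_dom.2 ⟨rfl, a, ha⟩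

/-- The unit at `ξ` is the germ `[e, ξ]` for any `e ∈ ξ`. -/
noncomputable def TightGerm.unit (ξ : TightFilter S) : TightGerm S :=
  TightGerm.mk ξ.1.nonempty.some (ξ.1.subset ξ.1.nonempty.some_mem).1 ξ
    (unit_dom ξ.1.nonempty.some_mem)

theorem TightGerm.mk_eq_unit {s : X ≃. X} {hs : s ∈ S} {ξ : TightFilter S}
    {hd : s.symm * s ∈ ξ.1.carrier} (h : s ∈ ξ.1.carrier) :
    TightGerm.mk s hs ξ hd = TightGerm.unit ξ := by
  have h0 := ξ.1.nonempty.some_mem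
  refine TightGerm.mk_eq.2 ⟨rfl, s * ξ.1.nonempty.some, ξ.1.mul_mem _ h _ h0, ?_⟩
  refine pext fun a b => ?_
  rw [mem_mul, mem_mul]
  constructor
  · rintro ⟨c, hc, hb⟩
    obtain rfl := ξ.1.idem h hb
    refine ⟨_, hc, ?_⟩
    obtain ⟨d, hd, hc'⟩ := mem_mul.1 hc
    obtain rfl := ξ.1.idem h hc'
    obtain rfl := ξ.1.idem h0 hd
    exact hd
  · rintro ⟨c, hc, hb⟩
    obtain rfl := ξ.1.idem h0 hb
    refine ⟨_, hc, ?_⟩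
    obtain ⟨d, hd, hc'⟩ := mem_mul.1 hc
    obtain rfl := ξ.1.idem h hc'
    exact hc'

theorem mul_symm_mul (s : X ≃. X) : s * s.symm * s = s := by
  refine pext fun a b => ?_
  rw [mul_assoc, mem_mul]
  constructor
  · rintro ⟨c, hc, hb⟩
    obtain ⟨rfl, -⟩ := mem_dom.1 hc
    exact hb
  · intro hb
    exact ⟨a, mem_dom.2 ⟨rfl, b, hb⟩, hb⟩

theorem dom_mem' {s : X ≃. X} (hs : s ∈ S) : s * s.symm ∈ S :=
  S.mul_mem hs (InverseClosed.symm_mem s hs)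

theorem TightGerm.mul_congr_left {a a' b : TightGerm S} (e : a = a') {h : a.src = b.rng}
    (h' : a'.src = b.rng) : TightGerm.mul a b h = TightGerm.mul a' b h' := by
  subst e
  rfl

theorem TightGerm.mul_congr_right {a b b' : TightGerm S} (e : b = b') {h : a.src = b.rng}
    (h' : a.src = b'.rng) : TightGerm.mul a b h = TightGerm.mul a b' h' := by
  subst e
  rfl

theorem TightGerm.src_mul (a b : TightGerm S) : ∀ h, (TightGerm.mul a b h).src = b.src := by
  induction a using TightGerm.ind with
  | h s hs ξ hd =>
  induction b using TightGerm.ind with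
  | h t ht ζ hd' =>
  intro h
  rw [TightGerm.mk_mul_mk h]
  rfl

theorem TightGerm.rng_mul (a b : TightGerm S) : ∀ h, (TightGerm.mul a b h).rng = a.rng := by
  induction a using TightGerm.ind with
  | h s hs ξ hd =>
  induction b using TightGerm.ind with
  | h t ht ζ hd' =>
  intro h
  rw [TightGerm.mk_mul_mk h]
  have h' : ξ = ζ.act t ht hd' := h
  have h'' := mk_dom_mul (hs := hs) (hd := hd) h'
  subst h'
  exact Subtype.ext (EFilter.act_mul hs ht hd' hd h'')

variable (S)

/-- The tight groupoid of `S`: the groupoid of germs of the action of `S` on tight filters. -/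
noncomputable def tightGroupoid : GroupoidOn (TightFilter S) (TightGerm S) where
  src := TightGerm.src
  rng := TightGerm.rng
  unit := TightGerm.unit
  mul := TightGerm.mul
  inv := TightGerm.inv
  src_mul := TightGerm.src_mul
  rng_mul := TightGerm.rng_mul
  src_unit ξ := rfl
  rng_unit ξ := Subtype.ext (EFilter.act_idem (η := ξ.1) (ξ.1.subset ξ.1.nonempty.some_mem)
    (unit_dom ξ.1.nonempty.some_mem))
  src_inv a := by
    induction a using TightGerm.ind with
    | h s hs ξ hd => rfl
  rng_inv a := by
    induction a using TightGerm.ind with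
    | h s hs ξ hd => exact Subtype.ext (EFilter.act_symm hs hd (inv_dom hs ξ hd))
  mul_assoc a b c := by
    induction a using TightGerm.ind with
    | h s hs ξ hd =>
    induction b using TightGerm.ind with
    | h t ht ζ hd' =>
    induction c using TightGerm.ind with
    | h u hu ω hd'' =>
    intro h h'
    have h1 := TightGerm.mk_mul_mk h
    have h2 := TightGerm.mk_mul_mk h'
    have h3 := TightGerm.mk_mul_mk (hs := S.mul_mem hs ht) (hd := mk_dom_mul (hs := hs) (hd := hd) h)
      (ht := hu) (hd' := hd'') h'
    have h4 := TightGerm.mk_mul_mk (hs := hs) (hd := hd) (ht := S.mul_mem ht hu)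
      (hd' := mk_dom_mul (hs := ht) (hd := hd') h') (by rw [← h2, TightGerm.rng_mul, ← h])
    exact (TightGerm.mul_congr_left h1 h').trans (h3.trans ((germ_mk_congr (mul_assoc _ _ _) rfl).trans
      (h4.symm.trans (TightGerm.mul_congr_right h2.symm _))))
  unit_mul a := by
    induction a using TightGerm.ind with
    | h s hs ξ hd =>
    have h1 : s * s.symm ∈ (ξ.act s hs hd).1.carrier := inv_dom hs ξ hd
    have h3 := (TightGerm.mk_eq_unit (hs := dom_mem' hs) (hd := unit_dom h1) h1).symm
    have h4 : (TightGerm.mk (s * s.symm) (dom_mem' hs) (ξ.act s hs hd) (unit_dom h1)).src =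
        (TightGerm.mk s hs ξ hd).rng := rfl
    refine (TightGerm.mul_congr_left h3 h4).trans ?_
    rw [TightGerm.mk_mul_mk]
    exact germ_mk_congr (mul_symm_mul s) rfl
  mul_unit a := by
    induction a using TightGerm.ind with
    | h s hs ξ hd =>
    have h1 : s.symm * s ∈ ξ.1.carrier := hd
    have h2 : s.symm * s ∈ S := (dom_mem hs).1
    have h3 := (TightGerm.mk_eq_unit (hs := h2) (hd := unit_dom h1) h1).symm
    have h4 : (TightGerm.mk s hs ξ hd).src =
        (TightGerm.mk (s.symm * s) h2 ξ (unit_dom h1)).rng :=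
      Subtype.ext (EFilter.act_idem (dom_mem hs) (η := ξ.1) (unit_dom h1)).symm
    refine (TightGerm.mul_congr_right h3 h4).trans ?_
    rw [TightGerm.mk_mul_mk]
    exact germ_mk_congr (by rw [← mul_assoc, mul_symm_mul]) rfl
  inv_mul a := by
    induction a using TightGerm.ind with
    | h s hs ξ hd =>
    have h := TightGerm.mk_mul_mk (hs := InverseClosed.symm_mem s hs) (ht := hs)
      (hd := inv_dom hs ξ hd) (hd' := hd) rfl
    exact h.trans (TightGerm.mk_eq_unit hd)
  mul_inv a := by
    induction a using TightGerm.ind with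
    | h s hs ξ hd =>
    have h1 : s * s.symm ∈ (ξ.act s hs hd).1.carrier := inv_dom hs ξ hd
    have h := TightGerm.mk_mul_mk (hs := hs) (ht := InverseClosed.symm_mem s hs)
      (hd := hd) (hd' := inv_dom hs ξ hd)
      (Subtype.ext (EFilter.act_symm hs hd (inv_dom hs ξ hd)).symm)
    exact h.trans (TightGerm.mk_eq_unit h1)

end TightGroupoid

/-! ### Semigroup actions and their groupoids -/

section SemigroupActions

variable {Q : Type*} [Group Q]

/-- The relation `g ≤ h` on `Γ ⊆ Q`: `g⁻¹ h ∈ Γ`. -/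
def SemigroupLE {Γ : Submonoid Q} (g h : Γ) : Prop := (g : Q)⁻¹ * (h : Q) ∈ Γ

/-- `Γ` is a join-semilattice: `Γ ∩ Γ⁻¹ = {1}` and any two elements of `Γ` have a (unique) least
upper bound in `Γ`. -/
structure IsJoinSemilattice (Γ : Submonoid Q) : Prop where
  eq_one : ∀ g ∈ Γ, g⁻¹ ∈ Γ → g = 1
  exists_join : ∀ g h : Γ, ∃! j : Γ, SemigroupLE g j ∧ SemigroupLE h j ∧
    ∀ k : Γ, SemigroupLE g k → SemigroupLE h k → SemigroupLE j k

/-- A (partial, right) action of the semigroup `Γ` on `X` by partial maps `T g`; the equation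
`T (g h) = T h ∘ T g` is one of partial maps, so it includes equality of domains. -/
structure SemigroupAction (Γ : Submonoid Q) (X : Type*) where
  T : Γ → X →. X
  one_act : ∀ x, T 1 x = Part.some x
  mul_act : ∀ g h x, T (g * h) x = (T g x).bind (T h)

variable {Γ : Submonoid Q} {X : Type*}

/-- The domain `U(g)` of `T g`. -/
def SemigroupAction.U (A : SemigroupAction Γ X) (g : Γ) : Set X := (A.T g).Dom

/-- For all `g`, `h` with `U(g) ∩ U(h) ≠ ∅` there is `r ≥ g, h` with `U(g) ∩ U(h) = U(r)`. -/
def SemigroupAction.IsDirected (A : SemigroupAction Γ X) : Prop :=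
  ∀ g h : Γ, (A.U g ∩ A.U h).Nonempty →
    ∃ r : Γ, SemigroupLE g r ∧ SemigroupLE h r ∧ A.U g ∩ A.U h = A.U r

/-- The set of arrows of the semigroup action groupoid: the triples `(x, g h⁻¹, y)` with `T g x`
and `T h y` defined and equal. -/
def SemigroupAction.Arrow (A : SemigroupAction Γ X) : Type _ :=
  {p : X × Q × X // ∃ g h : Γ, p.2.1 = (g : Q) * (h : Q)⁻¹ ∧ ∃ z, z ∈ A.T g p.1 ∧ z ∈ A.T h p.2.2}

/-- The set `Z(M, g, h, N)` of the arrows `(x, g h⁻¹, y)` with `x ∈ M`, `y ∈ N`, `T g x = T h y`. -/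
def SemigroupAction.Z (A : SemigroupAction Γ X) (M : Set X) (g h : Γ) (N : Set X) : Set A.Arrow :=
  {a | a.1.1 ∈ M ∧ a.1.2.1 = (g : Q) * (h : Q)⁻¹ ∧ a.1.2.2 ∈ N ∧
    ∃ z, z ∈ A.T g a.1.1 ∧ z ∈ A.T h a.1.2.2}

/-- The partial map `T` is injective on `M`. -/
def PInjOn (T : X →. X) (M : Set X) : Prop :=
  ∀ x ∈ M, ∀ y ∈ M, ∀ z, z ∈ T x → z ∈ T y → x = y

/-- The topology generated by the sets `Z(M, g, h, N)` with `M ⊆ U(g)`, `N ⊆ U(h)` open, `T g`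
injective on `M`, `T h` injective on `N`, and `T g (M) = T h (N)`. -/
instance [TopologicalSpace X] (A : SemigroupAction Γ X) : TopologicalSpace A.Arrow :=
  TopologicalSpace.generateFrom
    {W | ∃ (M : Set X) (g h : Γ) (N : Set X), IsOpen M ∧ IsOpen N ∧ M ⊆ A.U g ∧ N ⊆ A.U h ∧
      PInjOn (A.T g) M ∧ PInjOn (A.T h) N ∧ (A.T g).image M = (A.T h).image N ∧
      W = A.Z M g h N}

/-- The semigroup action groupoid of a directed action. -/
def actionGroupoid (A : SemigroupAction Γ X) (hA : A.IsDirected) : GroupoidOn X A.Arrow where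
  src a := a.1.2.2
  rng a := a.1.1
  unit x := ⟨(x, 1, x), 1, 1, by simp, x, by simp [A.one_act]⟩
  mul a b h := ⟨(a.1.1, a.1.2.1 * b.1.2.1, b.1.2.2), by
    obtain ⟨⟨x, q, y⟩, g, h1, hq, z, hz, hz'⟩ := a
    obtain ⟨⟨y', q', w⟩, k, l, hq', u, hu, hu'⟩ := b
    dsimp only at hq hz hz' hq' hu hu' h ⊢
    subst h
    obtain ⟨r, hr1, hr2, hr⟩ := hA h1 k ⟨y, hz'.1, hu.1⟩
    have hy : y ∈ A.U r := hr ▸ ⟨hz'.1, hu.1⟩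
    obtain ⟨v, hv⟩ : ∃ v, v ∈ A.T r y := Part.dom_iff_mem.1 hy
    have e1 : r = h1 * ⟨_, hr1⟩ := Subtype.ext (by simp)
    have e2 : r = k * ⟨_, hr2⟩ := Subtype.ext (by simp)
    have v1 := hv
    have v2 := hv
    rw [e1, A.mul_act] at v1
    rw [e2, A.mul_act] at v2
    obtain ⟨z1, hz1, v1⟩ := Part.mem_bind_iff.1 v1
    obtain ⟨u1, hu1, v2⟩ := Part.mem_bind_iff.1 v2
    obtain rfl := Part.mem_unique hz' hz1
    obtain rfl := Part.mem_unique hu hu1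
    refine ⟨g * ⟨_, hr1⟩, l * ⟨_, hr2⟩, ?_, v, ?_, ?_⟩
    · rw [hq, hq']
      simp [mul_assoc]
    · rw [A.mul_act]
      exact Part.mem_bind_iff.2 ⟨_, hz, v1⟩
    · rw [A.mul_act]
      exact Part.mem_bind_iff.2 ⟨_, hu', v2⟩⟩
  inv a := ⟨(a.1.2.2, (a.1.2.1)⁻¹, a.1.1), by
    obtain ⟨⟨x, q, y⟩, g, h, hq, z, hz, hz'⟩ := a
    dsimp only at hq
    exact ⟨h, g, by simp [hq], z, hz', hz⟩⟩
  src_mul _ _ _ := rfl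
  rng_mul _ _ _ := rfl
  src_unit _ := rfl
  rng_unit _ := rfl
  src_inv _ := rfl
  rng_inv _ := rfl
  mul_assoc _ _ _ _ _ := Subtype.ext (by simp [mul_assoc])
  unit_mul _ := Subtype.ext (by simp)
  mul_unit _ := Subtype.ext (by simp)
  inv_mul _ := Subtype.ext (by simp)
  mul_inv _ := Subtype.ext (by simp)

/-- The canonical map `(x, g h⁻¹, y) ↦ g h⁻¹`. -/
def SemigroupAction.cocycle (A : SemigroupAction Γ X) (a : A.Arrow) : Q := a.1.2.1

end SemigroupActions

/-! ### Left cancellative small categories -/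

section Categories

/-- The morphisms of a category; `α : Mor C` has source `α.s` and range `α.r`. -/
structure Mor (C : Type*) [Category C] where
  {s r : C}
  hom : s ⟶ r

variable {C : Type*} [Category C]

/-- `IsComp α β δ` says that the product `α β = α ∘ β` is defined, i.e. `α.s = β.r`, and equals
`δ`. -/
inductive IsComp : Mor C → Mor C → Mor C → Prop
  | mk {x y z : C} (f : x ⟶ y) (g : y ⟶ z) : IsComp ⟨g⟩ ⟨f⟩ ⟨f ≫ g⟩

/-- The set `αΛ` of the extensions of `α`. -/
def extensions (α : Mor C) : Set (Mor C) := {δ | ∃ β, IsComp α β δ}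

variable (C) in
/-- `α β = α γ` implies `β = γ`. -/
class LeftCancellative : Prop where
  cancel : ∀ α β γ δ : Mor C, IsComp α β δ → IsComp α γ δ → β = γ

variable (C) in
/-- For all `α`, `β` the set `αΛ ∩ βΛ` is a finite union of sets `γΛ`. -/
def FinitelyAligned : Prop :=
  ∀ α β : Mor C, ∃ F : Set (Mor C), F.Finite ∧
    extensions α ∩ extensions β = ⋃ γ ∈ F, extensions γ

theorem IsComp.unique {α β δ δ' : Mor C} (h : IsComp α β δ) (h' : IsComp α β δ') : δ = δ' := by
  cases h
  cases h'
  rfl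

theorem IsComp.src_eq {α β δ : Mor C} (h : IsComp α β δ) : α.s = β.r := by
  cases h
  rfl

theorem IsComp.r_eq {α β δ : Mor C} (h : IsComp α β δ) : δ.r = α.r := by
  cases h
  rfl

theorem IsComp.s_eq {α β δ : Mor C} (h : IsComp α β δ) : δ.s = β.s := by
  cases h
  rfl

theorem exists_isComp {α β : Mor C} (h : α.s = β.r) : ∃ δ, IsComp α β δ := by
  obtain ⟨f⟩ := α
  obtain ⟨g⟩ := β
  dsimp only at h
  subst h
  exact ⟨_, IsComp.mk g f⟩

theorem IsComp.assoc {α β γ δ ε : Mor C} (h : IsComp α β γ) (h' : IsComp γ δ ε) :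
    ∃ ζ, IsComp β δ ζ ∧ IsComp α ζ ε := by
  cases h with
  | mk f g =>
  cases h' with
  | mk k _ => exact ⟨_, IsComp.mk k f, by rw [← Category.assoc]; exact IsComp.mk _ _⟩

theorem IsComp.assoc' {α β δ ε ζ : Mor C} (h : IsComp β δ ζ) (h' : IsComp α ζ ε) :
    ∃ γ, IsComp α β γ ∧ IsComp γ δ ε := by
  cases h with
  | mk f g =>
  cases h' with
  | mk _ k => exact ⟨_, IsComp.mk g k, by rw [Category.assoc]; exact IsComp.mk _ _⟩

theorem id_isComp {v : C} {α : Mor C} (h : α.r = v) : IsComp ⟨𝟙 v⟩ α α := by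
  obtain ⟨f⟩ := α
  dsimp only at h
  subst h
  have := IsComp.mk f (𝟙 _)
  rwa [Category.comp_id] at this

theorem isComp_id {v : C} {α : Mor C} (h : α.s = v) : IsComp α ⟨𝟙 v⟩ α := by
  obtain ⟨f⟩ := α
  dsimp only at h
  subst h
  have := IsComp.mk (𝟙 _) f
  rwa [Category.id_comp] at this

theorem self_mem_extensions (α : Mor C) : α ∈ extensions α := ⟨_, isComp_id rfl⟩

variable [LeftCancellative C]

/-- `τ^α`, the bijection from `s(α)Λ` to `αΛ` with `β ↦ α β`. -/
noncomputable def tau (α : Mor C) : Mor C ≃. Mor C :=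
  ofRel (IsComp α) (fun _ _ _ h h' => h.unique h') (fun _ _ _ h h' => LeftCancellative.cancel _ _ _ _ h h')

/-- `σ^α`, the inverse bijection from `αΛ` to `s(α)Λ` with `α β ↦ β`. -/
noncomputable def sigma (α : Mor C) : Mor C ≃. Mor C := (tau α).symm

variable (C) in
/-- The semigroup generated by all `τ^α` and `σ^α`. -/
noncomputable def pathSemigroup : Subsemigroup (Mor C ≃. Mor C) :=
  Subsemigroup.closure (Set.range tau ∪ Set.range sigma)

theorem tau_mem (α : Mor C) : tau α ∈ pathSemigroup C :=
  Subsemigroup.subset_closure (Or.inl ⟨α, rfl⟩)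

theorem sigma_mem (α : Mor C) : sigma α ∈ pathSemigroup C :=
  Subsemigroup.subset_closure (Or.inr ⟨α, rfl⟩)

instance : InverseClosed (pathSemigroup C) where
  symm_mem s hs := by
    induction hs using Subsemigroup.closure_induction with
    | mem s hs =>
      rcases hs with ⟨α, rfl⟩ | ⟨α, rfl⟩
      · exact sigma_mem α
      · exact tau_mem α
    | mul s t _ _ h h' => exact (pathSemigroup C).mul_mem h' h

theorem mem_tau {α β δ : Mor C} : δ ∈ tau α β ↔ IsComp α β δ := mem_ofRel

theorem mem_sigma {α β δ : Mor C} : β ∈ sigma α δ ↔ IsComp α β δ := by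
  rw [sigma, mem_symm, mem_tau]

theorem mem_tau_sigma {α a b : Mor C} : b ∈ (tau α * sigma α) a ↔ b = a ∧ a ∈ extensions α := by
  rw [mem_mul]
  constructor
  · rintro ⟨c, hc, hb⟩
    rw [mem_sigma] at hc
    exact ⟨(mem_tau.1 hb).unique hc, c, hc⟩
  · rintro ⟨rfl, c, hc⟩
    exact ⟨c, mem_sigma.2 hc, mem_tau.2 hc⟩

theorem tau_sigma_idem (α : Mor C) : tau α * sigma α ∈ idempotents (pathSemigroup C) :=
  ⟨(pathSemigroup C).mul_mem (tau_mem α) (sigma_mem α),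
    idem_iff.2 fun _ _ h => (mem_tau_sigma.1 h).1⟩

variable (C) in
/-- The space of tight filters of the inverse semigroup of `C`. -/
abbrev TightSpace : Type _ := TightFilter (pathSemigroup C)

variable (C) in
/-- The space of arrows of the tight groupoid of the inverse semigroup of `C`. -/
abbrev TightArrow : Type _ := TightGerm (pathSemigroup C)

/-- `Δ_ξ`, the set of all `α` with `τ^α σ^α ∈ ξ`. -/
def delta (ξ : TightSpace C) : Set (Mor C) := {α | tau α * sigma α ∈ ξ.1.carrier}

theorem tauSigma_dom {α β : Mor C} (h : α.s = β.s) {ξ : TightSpace C} (hβ : β ∈ delta ξ) :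
    (tau α * sigma β).symm * (tau α * sigma β) ∈ ξ.1.carrier := by
  refine ξ.1.up' hβ (dom_mem ((pathSemigroup C).mul_mem (tau_mem α) (sigma_mem β))) fun a ha => ?_
  obtain ⟨-, c, hc⟩ := mem_tau_sigma.1 ha
  obtain ⟨d, hd⟩ := exists_isComp (h.trans hc.src_eq)
  exact mem_dom.2 ⟨rfl, d, mem_mul.2 ⟨c, mem_sigma.2 hc, mem_tau.2 hd⟩⟩

/-- `τ^α σ^β · ξ`, for `s(α) = s(β)` and `β ∈ Δ_ξ`. -/
noncomputable def pathAct (α β : Mor C) (h : α.s = β.s) (ξ : TightSpace C) (hβ : β ∈ delta ξ) :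
    TightSpace C :=
  ξ.act (tau α * sigma β) ((pathSemigroup C).mul_mem (tau_mem α) (sigma_mem β)) (tauSigma_dom h hβ)

/-- The germ `[τ^α σ^β, ξ]`, for `s(α) = s(β)` and `β ∈ Δ_ξ`. -/
noncomputable def pathGerm (α β : Mor C) (h : α.s = β.s) (ξ : TightSpace C) (hβ : β ∈ delta ξ) :
    TightArrow C :=
  TightGerm.mk (tau α * sigma β) ((pathSemigroup C).mul_mem (tau_mem α) (sigma_mem β)) ξ
    (tauSigma_dom h hβ)

theorem delta_hereditary {α β : Mor C} {ξ : TightSpace C} (h : β ∈ extensions α)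
    (hβ : β ∈ delta ξ) : α ∈ delta ξ := by
  refine ξ.1.up' hβ (tau_sigma_idem α) fun a ha => ?_
  obtain ⟨-, c, hc⟩ := mem_tau_sigma.1 ha
  obtain ⟨d, hd⟩ := h
  obtain ⟨e, -, he⟩ := hd.assoc hc
  exact mem_tau_sigma.2 ⟨rfl, e, he⟩

theorem EFilter.exists_mem {X : Type*} {S : Subsemigroup (X ≃. X)} (η : EFilter S) {e : X ≃. X}
    (he : e ∈ η.carrier) : ∃ a, a ∈ e a := by
  by_contra hcon
  refine η.zero_notMem ?_
  convert he
  refine pext fun a b => ?_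
  simp only [PEquiv.bot_apply, Option.mem_def, reduceCtorEq, false_iff]
  intro hb
  obtain rfl := η.idem he hb
  exact hcon ⟨_, hb⟩

theorem delta_meet {α β : Mor C} {ξ : TightSpace C} (hα : α ∈ delta ξ) (hβ : β ∈ delta ξ) :
    ∃ ε, ε ∈ extensions α ∧ ε ∈ extensions β := by
  obtain ⟨a, ha⟩ := ξ.1.exists_mem (ξ.1.mul_mem _ hα _ hβ)
  obtain ⟨b, hb, ha'⟩ := mem_mul.1 ha
  obtain ⟨rfl, h2⟩ := mem_tau_sigma.1 hb
  exact ⟨_, (mem_tau_sigma.1 ha').2, h2⟩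

theorem delta_directed (hC : FinitelyAligned C) {α β : Mor C} {ξ : TightSpace C}
    (hα : α ∈ delta ξ) (hβ : β ∈ delta ξ) :
    ∃ ε ∈ delta ξ, ε ∈ extensions α ∧ ε ∈ extensions β := by
  obtain ⟨F, hF, h⟩ := hC α β
  obtain ⟨_, ⟨ε, hε, rfl⟩, hε'⟩ := exists_mem_of_cover ξ.2 (ξ.1.mul_mem _ hα _ hβ)
    (hF.image fun γ => tau γ * sigma γ) (by
      rintro _ ⟨γ, -, rfl⟩
      exact tau_sigma_idem γ) (by
      intro a ha
      obtain ⟨b, hb, ha'⟩ := mem_mul.1 ha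
      obtain ⟨rfl, h2⟩ := mem_tau_sigma.1 hb
      have h3 : b ∈ extensions α ∩ extensions β := ⟨(mem_tau_sigma.1 ha').2, h2⟩
      rw [h] at h3
      simp only [Set.mem_iUnion] at h3
      obtain ⟨γ, hγ, h3⟩ := h3
      exact ⟨_, ⟨γ, hγ, rfl⟩, mem_tau_sigma.2 ⟨rfl, h3⟩⟩)
  have h4 : ε ∈ extensions α ∩ extensions β := by
    rw [h]
    simp only [Set.mem_iUnion]
    exact ⟨ε, hε, self_mem_extensions ε⟩
  exact ⟨ε, hε', h4.1, h4.2⟩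

theorem exists_vertex {s : Mor C ≃. Mor C} (hs : s ∈ pathSemigroup C) :
    (∃ v, ∀ a b, b ∈ s a → a.r = v) := by
  induction hs using Subsemigroup.closure_induction with
  | mem s hs =>
    rcases hs with ⟨α, rfl⟩ | ⟨α, rfl⟩
    · exact ⟨α.s, fun a b h => (mem_tau.1 h).src_eq.symm⟩
    · exact ⟨α.r, fun a b h => (mem_sigma.1 h).r_eq⟩
  | mul s t _ _ _ h =>
    obtain ⟨v, hv⟩ := h
    refine ⟨v, fun a b hb => ?_⟩
    obtain ⟨c, hc, -⟩ := mem_mul.1 hb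
    exact hv a c hc

theorem exists_id_mem_delta (ξ : TightSpace C) : ∃ v : C, (⟨𝟙 v⟩ : Mor C) ∈ delta ξ := by
  obtain ⟨e, he⟩ := ξ.1.nonempty
  obtain ⟨v, hv⟩ := exists_vertex (ξ.1.subset he).1
  exact ⟨v, ξ.1.up' he (tau_sigma_idem _) fun a ha =>
    mem_tau_sigma.2 ⟨rfl, a, id_isComp (hv a a ha)⟩⟩

end Categories

/-! ### `Γ`-graphs -/

section Graphs

variable {Q : Type*} [Group Q]

/-- A degree map that makes the category `C` a `Γ`-graph. -/
structure GammaGraph (Γ : Submonoid Q) (C : Type*) [Category C] where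
  deg : Mor C → Γ
  deg_mul : ∀ α β δ, IsComp α β δ → deg δ = deg α * deg β
  factorization : ∀ (δ : Mor C) (g₁ g₂ : Γ), deg δ = g₁ * g₂ →
    ∃! p : Mor C × Mor C, IsComp p.1 p.2 δ ∧ deg p.1 = g₁ ∧ deg p.2 = g₂

variable {Γ : Submonoid Q} {C : Type*} [Category C] (Λ : GammaGraph Γ C)

theorem deg_id (v : C) : Λ.deg ⟨𝟙 v⟩ = 1 := by
  have := Λ.deg_mul _ _ _ (id_isComp (α := ⟨𝟙 v⟩) rfl)
  exact (mul_eq_left.1 this.symm)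

variable [LeftCancellative C]

theorem delta_unique {α β : Mor C} {ξ : TightSpace C} (hα : α ∈ delta ξ) (hβ : β ∈ delta ξ)
    (h : Λ.deg α = Λ.deg β) : α = β := by
  obtain ⟨ε, ⟨a, ha⟩, b, hb⟩ := delta_meet hα hβ
  have h1 := Λ.deg_mul _ _ _ ha
  have h2 := Λ.deg_mul _ _ _ hb
  have h3 : Λ.deg b = Λ.deg a := by
    rw [h1, h] at h2
    exact (mul_left_cancel h2).symm
  have h4 := (Λ.factorization ε _ _ h2).unique (y₁ := (α, a)) (y₂ := (β, b))
    ⟨ha, h, h3.symm⟩ ⟨hb, rfl, rfl⟩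
  exact congrArg Prod.fst h4

/-- `σ^α · ξ`, for `α ∈ Δ_ξ`. -/
noncomputable def shift (α : Mor C) (ξ : TightSpace C) (hα : α ∈ delta ξ) : TightSpace C :=
  ξ.act (sigma α) (sigma_mem α) hα

/-- The partial map `T_g` on tight filters: `T_g(ξ) = σ^α · ξ` if there is an `α ∈ Δ_ξ` of
degree `g` (which is then unique). -/
noncomputable def shiftMap (g : Γ) : TightSpace C →. TightSpace C := fun ξ =>
  ⟨∃ α ∈ delta ξ, Λ.deg α = g, fun h => shift h.choose ξ h.choose_spec.1⟩

theorem mem_shiftMap {g : Γ} {ξ ζ : TightSpace C} :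
    ζ ∈ shiftMap Λ g ξ ↔ ∃ (α : Mor C) (hα : α ∈ delta ξ), Λ.deg α = g ∧ ζ = shift α ξ hα := by
  constructor
  · rintro ⟨h, rfl⟩
    exact ⟨h.choose, h.choose_spec.1, h.choose_spec.2, rfl⟩
  · rintro ⟨α, hα, h, rfl⟩
    have h1 : ∃ α ∈ delta ξ, Λ.deg α = g := ⟨α, hα, h⟩
    refine ⟨h1, ?_⟩
    have h2 : h1.choose = α :=
      delta_unique Λ h1.choose_spec.1 hα (h1.choose_spec.2.trans h.symm)
    change shift h1.choose ξ h1.choose_spec.1 = shift α ξ hα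
    congr 1

theorem tau_comp {α β δ : Mor C} (h : IsComp α β δ) : tau δ = tau α * tau β := by
  refine pext fun a b => ?_
  rw [mem_mul, mem_tau]
  constructor
  · intro hb
    obtain ⟨c, hc, hb⟩ := h.assoc hb
    exact ⟨c, mem_tau.2 hc, mem_tau.2 hb⟩
  · rintro ⟨c, hc, hb⟩
    obtain ⟨d, hd, hb⟩ := (mem_tau.1 hc).assoc' (mem_tau.1 hb)
    rwa [h.unique hd]

theorem sigma_comp {α β δ : Mor C} (h : IsComp α β δ) : sigma δ = sigma β * sigma α := by
  unfold sigma
  rw [tau_comp h, symm_mul]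

theorem mem_delta_comp {α β δ : Mor C} (h : IsComp α β δ) {ξ : TightSpace C} (hα : α ∈ delta ξ) :
    δ ∈ delta ξ ↔ β ∈ delta (shift α ξ hα) := by
  have h1 := EFilter.dom_mul (S := pathSemigroup C) (η := ξ.1) (sigma_mem β) (sigma_mem α) hα
  rw [← sigma_comp h] at h1
  exact h1

theorem shift_comp {α β δ : Mor C} (h : IsComp α β δ) {ξ : TightSpace C} (hα : α ∈ delta ξ)
    (hβ : β ∈ delta (shift α ξ hα)) (hδ : δ ∈ delta ξ) :
    shift δ ξ hδ = shift β (shift α ξ hα) hβ := by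
  have h2 : (sigma β * sigma α).symm * (sigma β * sigma α) ∈ ξ.1.carrier := by
    rw [← sigma_comp h]
    exact hδ
  have h1 := EFilter.act_mul (S := pathSemigroup C) (η := ξ.1) (sigma_mem β) (sigma_mem α) hα hβ h2
  refine Subtype.ext (Eq.trans ?_ h1)
  have key : ∀ (s t : Mor C ≃. Mor C) (hs : s ∈ pathSemigroup C) (ht : t ∈ pathSemigroup C)
      (hd : s.symm * s ∈ ξ.1.carrier) (hd' : t.symm * t ∈ ξ.1.carrier), s = t →
      ξ.1.act s hs hd = ξ.1.act t ht hd' := by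
    rintro s t hs ht hd hd' rfl
    rfl
  exact key _ _ (sigma_mem δ) _ hδ h2 (sigma_comp h)

/-- The action of `Γ` on the tight filters. -/
noncomputable def shiftAction : SemigroupAction Γ (TightSpace C) where
  T := shiftMap Λ
  one_act ξ := by
    obtain ⟨v, hv⟩ := exists_id_mem_delta ξ
    refine Part.eq_some_iff.2 ((mem_shiftMap Λ).2 ⟨_, hv, deg_id Λ v, ?_⟩)
    have h1 : sigma (⟨𝟙 v⟩ : Mor C) ∈ idempotents (pathSemigroup C) := by
      refine ⟨sigma_mem _, idem_iff.2 fun a b h => ?_⟩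
      rw [mem_sigma] at h
      exact ((id_isComp h.src_eq.symm).unique h)
    exact Subtype.ext (EFilter.act_idem h1 (η := ξ.1) hv).symm
  mul_act g h ξ := by
    refine Part.ext fun ζ => ?_
    refine (mem_shiftMap Λ).trans (Iff.trans ?_ Part.mem_bind_iff.symm)
    constructor
    · rintro ⟨δ, hδ, hg, rfl⟩
      obtain ⟨⟨α, β⟩, ⟨hc, h1, h2⟩, -⟩ := Λ.factorization δ g h hg
      have hα : α ∈ delta ξ := delta_hereditary ⟨β, hc⟩ hδ
      have hβ := (mem_delta_comp hc hα).1 hδ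
      exact ⟨_, (mem_shiftMap Λ).2 ⟨α, hα, h1, rfl⟩,
        (mem_shiftMap Λ).2 ⟨β, hβ, h2, shift_comp hc hα hβ hδ⟩⟩
    · rintro ⟨ω, hω, hζ⟩
      obtain ⟨α, hα, h1, rfl⟩ := (mem_shiftMap Λ).1 hω
      obtain ⟨β, hβ, h2, rfl⟩ := (mem_shiftMap Λ).1 hζ
      have h3 : α.s = β.r := by
        obtain ⟨a, ha⟩ := ξ.1.exists_mem
          (TightFilter.mem_act (hs := sigma_mem α) (hd := hα) |>.1 hβ).2
        obtain ⟨-, c, hc, hc'⟩ := (mem_conj (tau_sigma_idem β)).1 ha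
        obtain ⟨-, d, hd⟩ := mem_tau_sigma.1 hc'
        exact (mem_sigma.1 hc).src_eq.trans hd.r_eq
      obtain ⟨δ, hc⟩ := exists_isComp h3
      have hδ := (mem_delta_comp hc hα).2 hβ
      exact ⟨δ, hδ, by rw [Λ.deg_mul _ _ _ hc, h1, h2], (shift_comp hc hα hβ hδ).symm⟩

theorem mem_shiftAction_U {g : Γ} {ξ : TightSpace C} :
    ξ ∈ (shiftAction Λ).U g ↔ ∃ α ∈ delta ξ, Λ.deg α = g := Iff.rfl

/-- If `Γ` is a join-semilattice and `C` is finitely aligned, then the action is directed. -/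
theorem shiftAction_directed (hΓ : IsJoinSemilattice Γ) (hC : FinitelyAligned C) :
    (shiftAction Λ).IsDirected := by
  intro g h _
  obtain ⟨j, ⟨hgj, hhj, hj⟩, -⟩ := hΓ.exists_join g h
  have key : ∀ {g j : Γ}, SemigroupLE g j → ∀ {ξ : TightSpace C} {ε : Mor C}, ε ∈ delta ξ →
      Λ.deg ε = j → ∃ α ∈ delta ξ, Λ.deg α = g := by
    intro g j hgj ξ ε hε hd
    obtain ⟨⟨α, β⟩, ⟨hc, h1, -⟩, -⟩ := Λ.factorization ε g ⟨_, hgj⟩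
      (hd.trans (Subtype.ext (by simp)))
    exact ⟨α, delta_hereditary ⟨β, hc⟩ hε, h1⟩
  have hle : ∀ {α ε : Mor C}, ε ∈ extensions α → SemigroupLE (Λ.deg α) (Λ.deg ε) := by
    rintro α ε ⟨β, hβ⟩
    unfold SemigroupLE
    rw [Λ.deg_mul _ _ _ hβ]
    simp
  refine ⟨j, hgj, hhj, Set.ext fun ξ => ⟨?_, ?_⟩⟩
  · rintro ⟨h1, h2⟩
    obtain ⟨α, hα, rfl⟩ := (mem_shiftAction_U Λ).1 h1
    obtain ⟨β, hβ, rfl⟩ := (mem_shiftAction_U Λ).1 h2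
    obtain ⟨ε, hε, h1, h2⟩ := delta_directed hC hα hβ
    exact key (hj _ (hle h1) (hle h2)) hε rfl
  · intro h1
    obtain ⟨ε, hε, hd⟩ := (mem_shiftAction_U Λ).1 h1
    exact ⟨key hgj hε hd, key hhj hε hd⟩

end Graphs

end LCSC

open LCSC

/-! Finite alignment and tightness reduce every germ to a simple form. By `exists_finite_tau_sigma`
each element of the inverse semigroup is a finite union of maps `τ^α σ^β`: in a product `τ^α σ^β τ^γ
σ^δ` the overlap `βΛ ∩ γΛ` is a finite union of sets `εΛ`, and each `ε` contributes one such map.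
The sets `βΛ` of the pieces cover the domain of `s`, so if a tight filter `ξ` contains `s* s`, it
contains some `τ^β σ^β`. On `βΛ` the element `s` coincides with its piece, hence `[s, ξ] = [τ^α σ^β,
ξ]` (`exists_eq_pathGerm`).

The degree of a germ is read off from its effect on paths. The map `τ^α σ^β` sends `βc` to `αc`, so
it multiplies degrees on the left by `d(α) d(β)⁻¹`. Two representatives of a germ agree on an
idempotent of `ξ`, and finite products of idempotents of `ξ` are nonzero, so some path tests both;
this forces the factor to be unique (`HasDegree.unique`). A factor valid on an idempotent `e` serves
all germs of `s` at filters containing `e`, so the degree is locally constant, and factors multiply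
under composition.

Now `Φ(a) = (r(a), d̄(a), s(a))`, and compatibility with the operations is checked coordinatewise.
Surjectivity: `σ^α · x = σ^β · y` gives `x = τ^α σ^β · y` (`eq_pathAct_of_shift_eq`). Injectivity:
two germs over `ξ` can be rewritten with a common right path `ε ∈ Δ_ξ`; equal degrees then give left
paths of equal degree in `Δ` of the same range filter, and such paths coincide (`delta_unique`). The
same uniqueness matches the basic sets `Θ(τ^α σ^β, U)` with sets `Z(M, d(α), d(β), N)`, which makes
`Φ` a homeomorphism.

The tight groupoid is shown to be topological directly, using the charts `ξ ↦ [s, ξ]`. The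
corresponding statement for the action groupoid, and the continuity of its cocycle, are transported
along `Φ`. -/

namespace LCSC

/-! ### Transport of topological groupoid structures along isomorphisms -/

section TransportOfStructure

variable {X G Y H : Type*} [TopologicalSpace X] [TopologicalSpace G] [TopologicalSpace Y]
  [TopologicalSpace H] {𝓖 : GroupoidOn X G} {𝓗 : GroupoidOn Y H}

/-- A groupoid that is isomorphic to a topological groupoid is a topological groupoid. -/
theorem TopGroupoidIso.isTopological (Φ : TopGroupoidIso 𝓖 𝓗) (h : 𝓖.IsTopological) :
    𝓗.IsTopological := by
  -- Each structure map of `𝓗` is the conjugate by `Φ` of the one of `𝓖`, hence a composite of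
  -- continuous maps.
  have hsrc : ∀ a, 𝓗.src a = Φ.units (𝓖.src (Φ.arrows.symm a)) := fun a => by
    rw [← Φ.map_src, Homeomorph.apply_symm_apply]
  have hrng : ∀ a, 𝓗.rng a = Φ.units (𝓖.rng (Φ.arrows.symm a)) := fun a => by
    rw [← Φ.map_rng, Homeomorph.apply_symm_apply]
  have hunit : ∀ y, 𝓗.unit y = Φ.arrows (𝓖.unit (Φ.units.symm y)) := fun y => by
    rw [Φ.map_unit, Homeomorph.apply_symm_apply]
  have hinv : ∀ a, 𝓗.inv a = Φ.arrows (𝓖.inv (Φ.arrows.symm a)) := fun a => by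
    rw [Φ.map_inv, Homeomorph.apply_symm_apply]
  have hcomp : ∀ a b, 𝓗.src a = 𝓗.rng b →
      𝓖.src (Φ.arrows.symm a) = 𝓖.rng (Φ.arrows.symm b) := fun a b hab => by
    rw [hsrc, hrng] at hab
    exact Φ.units.injective hab
  have hmul : ∀ a b (hab : 𝓗.src a = 𝓗.rng b), 𝓗.mul a b hab =
      Φ.arrows (𝓖.mul (Φ.arrows.symm a) (Φ.arrows.symm b) (hcomp a b hab)) := fun a b hab => by
    rw [Φ.map_mul]
    congr 1 <;> rw [Homeomorph.apply_symm_apply]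
  refine ⟨?_, ?_, ?_, ?_, ?_⟩
  · rw [funext hsrc]
    exact Φ.units.continuous.comp (h.continuous_src.comp Φ.arrows.symm.continuous)
  · rw [funext hrng]
    exact Φ.units.continuous.comp (h.continuous_rng.comp Φ.arrows.symm.continuous)
  · rw [funext hunit]
    exact Φ.arrows.continuous.comp (h.continuous_unit.comp Φ.units.symm.continuous)
  · rw [funext hinv]
    exact Φ.arrows.continuous.comp (h.continuous_inv.comp Φ.arrows.symm.continuous)
  · simp only [hmul]
    refine Φ.arrows.continuous.comp (h.continuous_mul.comp
      (f := fun p : {p : H × H // 𝓗.src p.1 = 𝓗.rng p.2} =>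
        (⟨(Φ.arrows.symm p.1.1, Φ.arrows.symm p.1.2), hcomp _ _ p.2⟩ :
          {p : G × G // 𝓖.src p.1 = 𝓖.rng p.2})) ?_)
    exact Continuous.subtype_mk
      ((Φ.arrows.symm.continuous.comp (continuous_fst.comp continuous_subtype_val)).prodMk
        (Φ.arrows.symm.continuous.comp (continuous_snd.comp continuous_subtype_val))) _

end TransportOfStructure

/-! ### Topology of the tight groupoid -/

section TightTopology

variable {X : Type*} {S : Subsemigroup (X ≃. X)}

theorem isOpen_setOf_mem_carrier {e : X ≃. X} (he : e ∈ idempotents S) :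
    IsOpen {ξ : TightFilter S | e ∈ ξ.1.carrier} := by
  have h : IsOpen (basicOpen S {e} ∅) := isTopologicalBasis_basicOpen.isOpen
    ⟨{e}, ∅, Set.finite_singleton e, Set.finite_empty, Set.singleton_subset_iff.2 he,
      Set.empty_subset _, rfl⟩
  convert h.preimage continuous_subtype_val using 1
  ext ξ
  simp [basicOpen]

/-- The tight filters in the domain of `s`. -/
abbrev TightDomain (S : Subsemigroup (X ≃. X)) (s : X ≃. X) : Type _ :=
  {ξ : TightFilter S // s.symm * s ∈ ξ.1.carrier}

theorem TightGerm.mk_mem_basic {s : X ≃. X} {hs : s ∈ S} {ξ : TightFilter S}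
    {hd : s.symm * s ∈ ξ.1.carrier} {U : Set (TightFilter S)} :
    TightGerm.mk s hs ξ hd ∈ TightGerm.basic s hs U ↔ ξ ∈ U := by
  constructor
  · rintro ⟨ζ, hζ, hd', h⟩
    obtain ⟨rfl, -⟩ := TightGerm.mk_eq.1 h
    exact hζ
  · exact fun h => ⟨ξ, h, hd, rfl⟩

/-- Equality of germs is an open condition: if `s` and `t` agree on some `e ∈ ξ`, then they have the
same germ at every nearby filter in both domains, since containing `e` is an open condition. -/
theorem TightGerm.continuous_mk {s : X ≃. X} (hs : s ∈ S) :
    Continuous fun ξ : TightDomain S s => TightGerm.mk s hs ξ.1 ξ.2 := by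
  refine continuous_generateFrom_iff.2 ?_
  rintro _ ⟨t, ht, U, hU, hUt, rfl⟩
  refine isOpen_iff_forall_mem_open.2 ?_
  rintro ξ ⟨ζ, hζ, hd, h⟩
  obtain ⟨rfl, e, he, h'⟩ := TightGerm.mk_eq.1 h
  refine ⟨Subtype.val ⁻¹' (U ∩ {ξ | e ∈ ξ.1.carrier}), ?_,
    (hU.inter (isOpen_setOf_mem_carrier (ξ.1.1.subset he))).preimage continuous_subtype_val,
    hζ, he⟩
  rintro η ⟨hη, he'⟩
  exact ⟨η.1, hη, hUt _ hη, TightGerm.mk_eq.2 ⟨rfl, e, he', h'⟩⟩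

variable [InverseClosed S]

theorem isOpen_tightDomain {s : X ≃. X} (hs : s ∈ S) :
    IsOpen {ξ : TightFilter S | s.symm * s ∈ ξ.1.carrier} :=
  isOpen_setOf_mem_carrier (dom_mem hs)

theorem TightFilter.act_congr_point {s : X ≃. X} {hs : s ∈ S} {ξ ζ : TightFilter S} (h : ξ = ζ)
    {hd : s.symm * s ∈ ξ.1.carrier} (hd' : s.symm * s ∈ ζ.1.carrier) :
    ξ.act s hs hd = ζ.act s hs hd' := by
  subst h
  rfl

/-- Since `f ∈ s · ξ` means `s* f s ∈ ξ`, the preimage of a basic open set is the basic open set of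
the conjugated idempotents. -/
theorem TightFilter.continuous_act {s : X ≃. X} (hs : s ∈ S) :
    Continuous fun ξ : TightDomain S s => ξ.1.act s hs ξ.2 := by
  refine Continuous.subtype_mk (f := fun ξ : TightDomain S s => ξ.1.1.act s hs ξ.2) ?_ _
  refine continuous_generateFrom_iff.2 ?_
  rintro _ ⟨A, B, hA, hB, hA', hB', rfl⟩
  have h : IsOpen (basicOpen S ((fun f => s.symm * f * s) '' A) ((fun f => s.symm * f * s) '' B)) :=
    isTopologicalBasis_basicOpen.isOpen ⟨_, _, hA.image _, hB.image _,
      Set.image_subset_iff.2 fun f hf => conj_mem hs (hA' hf),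
      Set.image_subset_iff.2 fun f hf => conj_mem hs (hB' hf), rfl⟩
  convert h.preimage (continuous_subtype_val.comp continuous_subtype_val) using 1
  ext ξ
  refine and_congr ?_ ?_
  · rw [Set.image_subset_iff]
    exact forall₂_congr fun f hf =>
      EFilter.mem_act.trans (and_iff_right (hA' hf))
  · rw [Set.eq_empty_iff_forall_notMem, Set.eq_empty_iff_forall_notMem]
    constructor
    · rintro h _ ⟨⟨f, hf, rfl⟩, h'⟩
      exact h f ⟨hf, EFilter.mem_act.2 ⟨hB' hf, h'⟩⟩
    · rintro h f ⟨hf, h'⟩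
      exact h _ ⟨⟨f, hf, rfl⟩, (EFilter.mem_act.1 h').2⟩

theorem TightFilter.isOpen_act_preimage {s : X ≃. X} (hs : s ∈ S) {U : Set (TightFilter S)}
    (hU : IsOpen U) : IsOpen {ξ : TightFilter S | ∃ hd, ξ.act s hs hd ∈ U} := by
  convert (isOpen_tightDomain hs).isOpenMap_subtype_val _
    (hU.preimage (TightFilter.continuous_act hs)) using 1
  ext ξ
  constructor
  · rintro ⟨hd, h⟩
    exact ⟨⟨ξ, hd⟩, h, rfl⟩
  · rintro ⟨ζ, h, rfl⟩
    exact ⟨ζ.2, h⟩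

theorem TightGerm.isOpen_basic {s : X ≃. X} (hs : s ∈ S) {U : Set (TightFilter S)}
    (hU : IsOpen U) : IsOpen (TightGerm.basic s hs U) := by
  refine TopologicalSpace.isOpen_generateFrom_of_mem
    ⟨s, hs, U ∩ {ξ | s.symm * s ∈ ξ.1.carrier}, hU.inter (isOpen_tightDomain hs),
      fun ξ hξ => hξ.2, ?_⟩
  ext a
  constructor
  · rintro ⟨ξ, hξ, hd, rfl⟩
    exact ⟨ξ, ⟨hξ, hd⟩, hd, rfl⟩
  · rintro ⟨ξ, hξ, hd, rfl⟩
    exact ⟨ξ, hξ.1, hd, rfl⟩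

/-- For any fixed representative `s`, the sets `Θ(s, U)` already form a neighbourhood base at `[s,
ξ]`; other representatives are not needed. -/
theorem TightGerm.exists_basic_subset {s : X ≃. X} {hs : s ∈ S} {ξ : TightFilter S}
    {hd : s.symm * s ∈ ξ.1.carrier} {V : Set (TightGerm S)} (hV : IsOpen V)
    (h : TightGerm.mk s hs ξ hd ∈ V) :
    ∃ U : Set (TightFilter S), IsOpen U ∧ ξ ∈ U ∧ TightGerm.basic s hs U ⊆ V := by
  refine ⟨_, (isOpen_tightDomain hs).isOpenMap_subtype_val _
    (hV.preimage (TightGerm.continuous_mk hs)), ⟨⟨ξ, hd⟩, h, rfl⟩, ?_⟩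
  rintro _ ⟨_, ⟨ζ, hζ, rfl⟩, hd', rfl⟩
  exact hζ

/-- The charts `ξ ↦ [s, ξ]` send open sets to open sets and their images cover the space of germs,
so continuity may be tested on them. -/
theorem TightGerm.continuous_of_comp_mk {Y : Type*} [TopologicalSpace Y] {f : TightGerm S → Y}
    (h : ∀ s (hs : s ∈ S), Continuous fun ξ : TightDomain S s =>
      f (TightGerm.mk s hs ξ.1 ξ.2)) : Continuous f := by
  refine continuous_def.2 fun V hV => isOpen_iff_forall_mem_open.2 fun a ha => ?_
  induction a using TightGerm.ind with
  | h s hs ξ hd =>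
  refine ⟨_, ?_, TightGerm.isOpen_basic hs ((isOpen_tightDomain hs).isOpenMap_subtype_val _
    (hV.preimage (h s hs))), TightGerm.mk_mem_basic.2 ⟨⟨ξ, hd⟩, ha, rfl⟩⟩
  rintro _ ⟨_, ⟨ζ, hζ, rfl⟩, hd', rfl⟩
  exact hζ

theorem TightGerm.continuous_rng : Continuous (TightGerm.rng (S := S)) :=
  TightGerm.continuous_of_comp_mk fun _ hs => TightFilter.continuous_act hs

theorem TightGerm.continuous_inv : Continuous (TightGerm.inv (S := S)) :=
  TightGerm.continuous_of_comp_mk fun s hs =>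
    (TightGerm.continuous_mk (InverseClosed.symm_mem s hs)).comp
      (f := fun ξ : TightDomain S s =>
        (⟨ξ.1.act s hs ξ.2, inv_dom hs ξ.1 ξ.2⟩ : TightDomain S s.symm))
      ((TightFilter.continuous_act hs).subtype_mk _)

theorem TightGerm.continuous_unit : Continuous (TightGerm.unit (S := S)) := by
  refine continuous_def.2 fun V hV => isOpen_iff_forall_mem_open.2 fun ξ hξ => ?_
  -- The idempotent chosen in the definition of the unit varies with the filter; near `ξ` it is
  -- replaced by one fixed `e ∈ ξ`, which represents the unit at every filter containing it.
  obtain ⟨e, he⟩ := ξ.1.nonempty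
  have he' := ξ.1.subset he
  have h : TightGerm.mk e he'.1 ξ (unit_dom he) ∈ V := by
    rw [TightGerm.mk_eq_unit he]
    exact hξ
  obtain ⟨U, hU, hξU, hUV⟩ := TightGerm.exists_basic_subset hV h
  refine ⟨U ∩ {ζ | e ∈ ζ.1.carrier}, ?_, hU.inter (isOpen_setOf_mem_carrier he'), hξU, he⟩
  rintro ζ ⟨hζ, heζ⟩
  rw [Set.mem_preimage, ← TightGerm.mk_eq_unit (hs := he'.1) (hd := unit_dom heζ) heζ]
  exact hUV (TightGerm.mk_mem_basic.2 hζ)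

theorem TightGerm.continuous_mul :
    Continuous fun p : {p : TightGerm S × TightGerm S // p.1.src = p.2.rng} =>
      TightGerm.mul p.1.1 p.1.2 p.2 := by
  refine continuous_def.2 fun V hV => isOpen_iff_forall_mem_open.2 ?_
  rintro ⟨⟨a, b⟩, h⟩ hab
  induction a using TightGerm.ind with
  | h s hs ξ hd =>
  induction b using TightGerm.ind with
  | h t ht ζ hd' =>
  rw [Set.mem_preimage, TightGerm.mk_mul_mk h] at hab
  obtain ⟨U, hU, hζ, hUV⟩ := TightGerm.exists_basic_subset hV hab
  -- The product of `[s, ξ']` and `[t, ζ']` is `[s t, ζ']`, so only the second factor has to be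
  -- confined to `U`.
  refine ⟨Subtype.val ⁻¹' (TightGerm.basic s hs Set.univ ×ˢ TightGerm.basic t ht U), ?_,
    ((TightGerm.isOpen_basic hs isOpen_univ).prod (TightGerm.isOpen_basic ht hU)).preimage
      continuous_subtype_val,
    TightGerm.mk_mem_basic.2 trivial, TightGerm.mk_mem_basic.2 hζ⟩
  rintro ⟨⟨_, _⟩, h'⟩ ⟨⟨ξ', -, hd1, rfl⟩, ζ', hζ', hd2, rfl⟩
  rw [Set.mem_preimage, TightGerm.mk_mul_mk h']
  exact hUV (TightGerm.mk_mem_basic.2 hζ')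

variable (S) in
theorem tightGroupoid_isTopological : (tightGroupoid S).IsTopological where
  continuous_src := TightGerm.continuous_of_comp_mk fun _ _ => continuous_subtype_val
  continuous_rng := TightGerm.continuous_rng
  continuous_unit := TightGerm.continuous_unit
  continuous_inv := TightGerm.continuous_inv
  continuous_mul := TightGerm.continuous_mul

end TightTopology

end LCSC
namespace LCSC

/-! ### Germs of the path semigroup -/

section PathGerms

variable {C : Type*} [Category C]

theorem exists_isComp_of_mem_extensions {α β δ : Mor C} (h : α.s = β.s) (hδ : δ ∈ extensions β) :
    ∃ c η, IsComp β c δ ∧ IsComp α c η := by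
  obtain ⟨c, hc⟩ := hδ
  obtain ⟨η, hη⟩ := exists_isComp (h.trans hc.src_eq)
  exact ⟨c, η, hc, hη⟩

variable [LeftCancellative C]

theorem mem_tau_mul_sigma {α β a b : Mor C} :
    b ∈ (tau α * sigma β) a ↔ ∃ c, IsComp β c a ∧ IsComp α c b := by
  simp only [mem_mul, mem_sigma, mem_tau]

/-- The elements of the path semigroup of a finitely aligned category are finite unions of the
maps `τ^α σ^β`. -/
theorem exists_finite_tau_sigma (hC : FinitelyAligned C) {s : Mor C ≃. Mor C}
    (hs : s ∈ pathSemigroup C) :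
    ∃ F : Set (Mor C × Mor C), F.Finite ∧ (∀ p ∈ F, p.1.s = p.2.s) ∧
      ∀ a b, b ∈ s a ↔ ∃ p ∈ F, b ∈ (tau p.1 * sigma p.2) a := by
  induction hs using Subsemigroup.closure_induction with
  | mem s hs =>
    rcases hs with ⟨α, rfl⟩ | ⟨α, rfl⟩
    · refine ⟨{(α, ⟨𝟙 α.s⟩)}, Set.finite_singleton _, by simp, fun a b => ?_⟩
      simp only [Set.mem_singleton_iff, exists_eq_left, mem_tau_mul_sigma, mem_tau]
      constructor
      · exact fun h => ⟨a, id_isComp h.src_eq.symm, h⟩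
      · rintro ⟨c, hc, h⟩
        rwa [hc.unique (id_isComp h.src_eq.symm)]
    · refine ⟨{(⟨𝟙 α.s⟩, α)}, Set.finite_singleton _, by simp, fun a b => ?_⟩
      simp only [Set.mem_singleton_iff, exists_eq_left, mem_tau_mul_sigma, mem_sigma]
      constructor
      · exact fun h => ⟨b, h, id_isComp h.src_eq.symm⟩
      · rintro ⟨c, h, hc⟩
        rwa [hc.unique (id_isComp h.src_eq.symm)]
  | mul s t _ _ hs ht =>
    obtain ⟨F, hF, hFs, hF'⟩ := hs
    obtain ⟨G, hG, hGs, hG'⟩ := ht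
    choose E hE hE' using hC
    -- For a piece `p` of `s`, a piece `q` of `t` and a generator `ε = p.2 b = q.1 c` of the overlap
    -- of `p.2 Λ` and `q.1 Λ`, the new piece is the pair `(p.1 b, q.2 c)`.
    refine ⟨⋃ p ∈ F, ⋃ q ∈ G, ⋃ ε ∈ E p.2 q.1,
      {r | ∃ b c, IsComp p.2 b ε ∧ IsComp q.1 c ε ∧ IsComp p.1 b r.1 ∧ IsComp q.2 c r.2},
      ?_, ?_, fun x z => ?_⟩
    · refine hF.biUnion fun p _ => hG.biUnion fun q _ => (hE _ _).biUnion fun ε _ => ?_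
      -- By left cancellation `ε` determines `b` and `c`, so each triple `(p, q, ε)` contributes at
      -- most one pair.
      refine Set.Subsingleton.finite ?_
      rintro ⟨r1, r2⟩ ⟨b, c, h1, h2, h3, h4⟩ ⟨r1', r2'⟩ ⟨b', c', h1', h2', h3', h4'⟩
      obtain rfl := LeftCancellative.cancel _ _ _ _ h1 h1'
      obtain rfl := LeftCancellative.cancel _ _ _ _ h2 h2'
      exact Prod.ext (h3.unique h3') (h4.unique h4')
    · simp only [Set.mem_iUnion]
      rintro r ⟨p, -, q, -, ε, -, b, c, h1, h2, h3, h4⟩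
      exact h3.s_eq.trans (h1.s_eq.symm.trans (h2.s_eq.trans h4.s_eq.symm))
    · rw [mem_mul]
      constructor
      · rintro ⟨y, hy, hz⟩
        obtain ⟨q, hq, hy⟩ := (hG' _ _).1 hy
        obtain ⟨p, hp, hz⟩ := (hF' _ _).1 hz
        obtain ⟨v, hv, hv'⟩ := mem_tau_mul_sigma.1 hy
        obtain ⟨u, hu, hu'⟩ := mem_tau_mul_sigma.1 hz
        -- The intermediate path `y` factors as `ε w`; cancellation then gives `u = b w` and `v = c
        -- w`, so that `x = (q.2 c) w` and `z = (p.1 b) w`.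
        have hyE : y ∈ extensions p.2 ∩ extensions q.1 := ⟨⟨u, hu⟩, v, hv'⟩
        rw [hE'] at hyE
        obtain ⟨ε, hε, w, hw⟩ := Set.mem_iUnion₂.1 hyE
        have hεE : ε ∈ extensions p.2 ∩ extensions q.1 := by
          rw [hE']
          exact Set.mem_iUnion₂.2 ⟨ε, hε, self_mem_extensions ε⟩
        obtain ⟨⟨b, hb⟩, c, hc⟩ := hεE
        obtain ⟨u', hu1, hu2⟩ := hb.assoc hw
        obtain ⟨v', hv1, hv2⟩ := hc.assoc hw
        obtain rfl := LeftCancellative.cancel _ _ _ _ hu hu2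
        obtain rfl := LeftCancellative.cancel _ _ _ _ hv' hv2
        obtain ⟨r1, hr1, hz⟩ := hu1.assoc' hu'
        obtain ⟨r2, hr2, hx⟩ := hv1.assoc' hv
        refine ⟨(r1, r2), ?_, mem_tau_mul_sigma.2 ⟨w, hx, hz⟩⟩
        simp only [Set.mem_iUnion]
        exact ⟨p, hp, q, hq, ε, hε, b, c, hb, hc, hr1, hr2⟩
      · rintro ⟨r, hr, hz⟩
        simp only [Set.mem_iUnion] at hr
        obtain ⟨p, hp, q, hq, ε, -, b, c, h1, h2, h3, h4⟩ := hr
        obtain ⟨w, hx, hz⟩ := mem_tau_mul_sigma.1 hz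
        -- Conversely, the intermediate path is recovered as `y = ε w`.
        obtain ⟨y, hy⟩ := exists_isComp (h1.s_eq.trans (h3.s_eq.symm.trans hz.src_eq))
        obtain ⟨u, hu, hyu⟩ := h1.assoc hy
        obtain ⟨v, hv, hyv⟩ := h2.assoc hy
        obtain ⟨u', hu', hz'⟩ := h3.assoc hz
        obtain ⟨v', hv', hx'⟩ := h4.assoc hx
        obtain rfl := hu.unique hu'
        obtain rfl := hv.unique hv'
        exact ⟨y, (hG' _ _).2 ⟨q, hq, mem_tau_mul_sigma.2 ⟨v, hx', hyv⟩⟩,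
          (hF' _ _).2 ⟨p, hp, mem_tau_mul_sigma.2 ⟨u, hyu, hz'⟩⟩⟩

/-- This is where tightness enters: the finitely many sets `βΛ` cover the domain of `s`, so one of
the idempotents `τ^β σ^β` lies in `ξ`. -/
theorem exists_eq_pathGerm (hC : FinitelyAligned C) (a : TightArrow C) :
    ∃ (α β : Mor C) (h : α.s = β.s) (ξ : TightSpace C) (hβ : β ∈ delta ξ),
      a = pathGerm α β h ξ hβ := by
  induction a using TightGerm.ind with
  | h s hs ξ hd =>
  obtain ⟨F, hF, hFs, hF'⟩ := exists_finite_tau_sigma hC hs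
  obtain ⟨_, ⟨⟨α, β⟩, hp, rfl⟩, hβ⟩ := exists_mem_of_cover ξ.2 hd
    (hF.image fun p => tau p.2 * sigma p.2) (by
      rintro _ ⟨p, -, rfl⟩
      exact tau_sigma_idem p.2)
    (by
      intro a ha
      obtain ⟨-, b, hb⟩ := mem_dom.1 ha
      obtain ⟨p, hp, hb⟩ := (hF' _ _).1 hb
      obtain ⟨c, hc, -⟩ := mem_tau_mul_sigma.1 hb
      exact ⟨_, ⟨p, hp, rfl⟩, mem_tau_sigma.2 ⟨rfl, c, hc⟩⟩)
  refine ⟨α, β, hFs _ hp, ξ, hβ, TightGerm.mk_eq.2 ⟨rfl, _, hβ, pext fun a b => ?_⟩⟩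
  rw [mem_mul, mem_mul]
  refine exists_congr fun c => and_congr_right fun hc => ?_
  -- At a path of `βΛ` both maps are defined and `s` extends `τ^α σ^β`; since `s` is single valued,
  -- they agree there.
  obtain ⟨rfl, hc⟩ := mem_tau_sigma.1 hc
  obtain ⟨d, η, hd, hη⟩ := exists_isComp_of_mem_extensions (hFs _ hp) hc
  have h1 : η ∈ (tau α * sigma β) c := mem_tau_mul_sigma.2 ⟨d, hd, hη⟩
  have h2 : η ∈ s c := (hF' _ _).2 ⟨(α, β), hp, h1⟩
  constructor
  · intro hb
    rwa [mem_fun hb h2]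
  · intro hb
    rwa [mem_fun hb h1]

/-! ### The maps `σ^α` and `τ^α σ^β` on tight filters -/

theorem mem_delta_of_tauSigma_dom {α β : Mor C} {ξ : TightSpace C}
    (hd : (tau α * sigma β).symm * (tau α * sigma β) ∈ ξ.1.carrier) : β ∈ delta ξ :=
  EFilter.dom_of_dom_mul (S := pathSemigroup C) (η := ξ.1) (sigma_mem β) hd

theorem tau_dom_mem {α β : Mor C} (h : α.s = β.s) {ξ : TightSpace C} (hβ : β ∈ delta ξ) :
    (tau α).symm * tau α ∈ (shift β ξ hβ).1.carrier :=
  (EFilter.dom_mul (S := pathSemigroup C) (η := ξ.1) (tau_mem α) (sigma_mem β) hβ).1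
    (tauSigma_dom h hβ)

theorem pathAct_eq_tau_act {α β : Mor C} (h : α.s = β.s) {ξ : TightSpace C} (hβ : β ∈ delta ξ) :
    pathAct α β h ξ hβ = (shift β ξ hβ).act (tau α) (tau_mem α) (tau_dom_mem h hβ) :=
  Subtype.ext (EFilter.act_mul (S := pathSemigroup C) (η := ξ.1) (tau_mem α) (sigma_mem β) hβ
    (tau_dom_mem h hβ) (tauSigma_dom h hβ))

/-- `τ^α σ^α` is the range idempotent of `τ^α`, so it belongs to every filter `τ^α · η`. -/
theorem mem_delta_pathAct {α β : Mor C} (h : α.s = β.s) {ξ : TightSpace C} (hβ : β ∈ delta ξ) :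
    α ∈ delta (pathAct α β h ξ hβ) := by
  rw [pathAct_eq_tau_act]
  exact inv_dom (tau_mem α) _ (tau_dom_mem h hβ)

theorem shift_congr {α : Mor C} {ξ ζ : TightSpace C} (h : ξ = ζ) (hα : α ∈ delta ξ)
    (hα' : α ∈ delta ζ) : shift α ξ hα = shift α ζ hα' := by
  subst h
  rfl

theorem shift_pathAct {α β : Mor C} (h : α.s = β.s) {ξ : TightSpace C} (hβ : β ∈ delta ξ) :
    shift α (pathAct α β h ξ hβ) (mem_delta_pathAct h hβ) = shift β ξ hβ := by
  have h1 := inv_dom (tau_mem α) _ (tau_dom_mem h hβ)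
  exact (shift_congr (pathAct_eq_tau_act h hβ) _ h1).trans
    (Subtype.ext (EFilter.act_symm (S := pathSemigroup C) (tau_mem α) (tau_dom_mem h hβ) h1))

/-- Acting by `τ^α`, the inverse of `σ^α`, recovers `ξ` from `σ^α · ξ`. -/
theorem shift_injective {α : Mor C} {ξ ζ : TightSpace C} (hα : α ∈ delta ξ) (hα' : α ∈ delta ζ)
    (h : shift α ξ hα = shift α ζ hα') : ξ = ζ := by
  have key : ∀ {ξ : TightSpace C} (hα : α ∈ delta ξ), (shift α ξ hα).act (sigma α).symm
      (tau_mem α) (inv_dom (sigma_mem α) ξ hα) = ξ := fun {ξ} hα =>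
    Subtype.ext (EFilter.act_symm (S := pathSemigroup C) (sigma_mem α) hα
      (inv_dom (sigma_mem α) ξ hα))
  rw [← key hα, ← key hα']
  exact TightFilter.act_congr_point h _

theorem id_mem_delta_shift {α : Mor C} {ξ : TightSpace C} (hα : α ∈ delta ξ) :
    (⟨𝟙 α.s⟩ : Mor C) ∈ delta (shift α ξ hα) :=
  (mem_delta_comp (isComp_id rfl) hα).1 hα

/-- The filter `σ^α · ξ` contains the idempotent of `s(α)Λ`. Such idempotents at distinct vertices
have empty product, so a filter contains at most one of them. -/
theorem source_eq_of_shift_eq {α β : Mor C} {ξ ζ : TightSpace C} (hα : α ∈ delta ξ)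
    (hβ : β ∈ delta ζ) (h : shift α ξ hα = shift β ζ hβ) : α.s = β.s := by
  have h1 := id_mem_delta_shift hα
  rw [h] at h1
  obtain ⟨x, hx⟩ := EFilter.exists_mem _ ((shift β ζ hβ).1.mul_mem _ h1 _ (id_mem_delta_shift hβ))
  obtain ⟨y, hy, hx⟩ := mem_mul.1 hx
  obtain ⟨rfl, c, hc⟩ := mem_tau_sigma.1 hy
  obtain ⟨-, d, hd⟩ := mem_tau_sigma.1 hx
  exact hd.r_eq.symm.trans hc.r_eq

/-- Both `ξ` and `τ^α σ^β · ζ` are carried by `σ^α` to `σ^β · ζ`. This turns the defining relation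
`T_g(x) = T_h(y)` of the action groupoid into the action of a single `τ^α σ^β`. -/
theorem eq_pathAct_of_shift_eq {α β : Mor C} {ξ ζ : TightSpace C} (hα : α ∈ delta ξ)
    (hβ : β ∈ delta ζ) (h : shift α ξ hα = shift β ζ hβ) :
    ξ = pathAct α β (source_eq_of_shift_eq hα hβ h) ζ hβ :=
  shift_injective hα (mem_delta_pathAct _ hβ) (h.trans (shift_pathAct _ hβ).symm)

/-- `[τ^α σ^β, ξ] = [τ^{αγ} σ^{βγ}, ξ]`. -/
theorem pathGerm_comp {α β γ α' β' : Mor C} (h : α.s = β.s) {ξ : TightSpace C}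
    (hβ : β ∈ delta ξ) (hα' : IsComp α γ α') (hβ' : IsComp β γ β') (h' : α'.s = β'.s)
    (hδ : β' ∈ delta ξ) : pathGerm α β h ξ hβ = pathGerm α' β' h' ξ hδ := by
  refine TightGerm.mk_eq.2 ⟨rfl, _, hδ, pext fun a b => ?_⟩
  rw [mem_mul, mem_mul]
  refine exists_congr fun c => and_congr_right fun hc => ?_
  obtain ⟨rfl, d, hd⟩ := mem_tau_sigma.1 hc
  rw [mem_tau_mul_sigma, mem_tau_mul_sigma]
  obtain ⟨e, he, he'⟩ := hβ'.assoc hd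
  constructor
  · rintro ⟨c', hc', hb⟩
    obtain rfl := LeftCancellative.cancel _ _ _ _ he' hc'
    obtain ⟨f, hf, hb⟩ := he.assoc' hb
    obtain rfl := hf.unique hα'
    exact ⟨d, hd, hb⟩
  · rintro ⟨c', hc', hb⟩
    obtain rfl := LeftCancellative.cancel _ _ _ _ hd hc'
    obtain ⟨f, hf, hb⟩ := hα'.assoc hb
    obtain rfl := hf.unique he
    exact ⟨f, he', hb⟩

theorem pathGerm_congr {α α' β : Mor C} (e : α = α') {h : α.s = β.s} {ξ : TightSpace C}
    {hβ : β ∈ delta ξ} (h' : α'.s = β.s) :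
    pathGerm α β h ξ hβ = pathGerm α' β h' ξ hβ := by
  subst e
  rfl

end PathGerms

/-! ### The degree cocycle on the tight groupoid -/

section Degree

variable {Q : Type*} [Group Q] {Γ : Submonoid Q} {C : Type*} [Category C] [LeftCancellative C]
  (Λ : GammaGraph Γ C)

/-- The partial bijection `s` multiplies degrees by `q` from the left on the domain of `e`. -/
def ShiftsDegree (s e : Mor C ≃. Mor C) (q : Q) : Prop :=
  ∀ x y, x ∈ e x → y ∈ s x → (Λ.deg y : Q) = q * Λ.deg x

/-- The germ `a` has degree `q`: it has a representative that multiplies degrees by `q`. -/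
def HasDegree (a : TightArrow C) (q : Q) : Prop :=
  ∃ s hs ξ hd, a = TightGerm.mk s hs ξ hd ∧ ∃ e ∈ ξ.1.carrier, ShiftsDegree Λ s e q

variable {Λ}

theorem HasDegree.unique {a : TightArrow C} {q q' : Q} (h : HasDegree Λ a q)
    (h' : HasDegree Λ a q') : q = q' := by
  obtain ⟨s, hs, ξ, hd, rfl, e, he, hq⟩ := h
  obtain ⟨t, ht, ζ, hd', h, f, hf, hq'⟩ := h'
  obtain ⟨rfl, k, hk, hst⟩ := TightGerm.mk_eq.1 h
  -- A path in the domain of `s` and of all three idempotents: `s` shifts degrees by `q` on `e`, `t`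
  -- by `q'` on `f`, and `s` and `t` agree on `k`. The common image of this path then gives `q =
  -- q'`.
  obtain ⟨x, hx⟩ := ξ.1.exists_mem (ξ.1.mul_mem _ (ξ.1.mul_mem _ he _ hf) _
    (ξ.1.mul_mem _ hk _ hd))
  obtain ⟨x1, hx1, hx⟩ := mem_mul.1 hx
  obtain ⟨x2, hx2, hkx⟩ := mem_mul.1 hx1
  obtain ⟨rfl, y, hy⟩ := mem_dom.1 hx2
  obtain rfl := ξ.1.idem hk hkx
  obtain ⟨x3, hx3, hex⟩ := mem_mul.1 hx
  obtain rfl := ξ.1.idem hf hx3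
  have h1 : y ∈ (s * k) x3 := mem_mul.2 ⟨_, hkx, hy⟩
  rw [hst] at h1
  obtain ⟨x4, hx4, hty⟩ := mem_mul.1 h1
  obtain rfl := ξ.1.idem hk hx4
  exact mul_right_cancel ((hq _ _ hex hy).symm.trans (hq' _ _ hx3 hty))

/-- `τ^α σ^β` sends `βc` to `αc`, and the degree of `c` cancels. -/
theorem hasDegree_pathGerm {α β : Mor C} (h : α.s = β.s) {ξ : TightSpace C} (hβ : β ∈ delta ξ) :
    HasDegree Λ (pathGerm α β h ξ hβ) ((Λ.deg α : Q) * (Λ.deg β : Q)⁻¹) := by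
  refine ⟨_, _, ξ, _, rfl, _, hβ, fun x y _ hy => ?_⟩
  obtain ⟨c, hx, hy⟩ := mem_tau_mul_sigma.1 hy
  simp [Λ.deg_mul _ _ _ hx, Λ.deg_mul _ _ _ hy]

theorem HasDegree.mul {a b : TightArrow C} {q q' : Q} (ha : HasDegree Λ a q)
    (hb : HasDegree Λ b q') (h : a.src = b.rng) :
    HasDegree Λ (TightGerm.mul a b h) (q * q') := by
  obtain ⟨s, hs, ξ, hd, rfl, e, he, hq⟩ := ha
  obtain ⟨t, ht, ζ, hd', rfl, f, hf, hq'⟩ := hb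
  rw [TightGerm.mk_mul_mk h]
  obtain rfl : ξ = ζ.act t ht hd' := h
  have he' := TightFilter.mem_act.1 he
  -- On `f (t* e t)` the map `t` shifts degrees by `q'` and lands in `e`, where `s` shifts them by
  -- `q`.
  refine ⟨_, _, _, _, rfl, _, ζ.1.mul_mem _ hf _ he'.2, fun x z hx hz => ?_⟩
  obtain ⟨x', hx', hx⟩ := mem_mul.1 hx
  obtain ⟨rfl, y, hy, hey⟩ := (mem_conj he'.1).1 hx'
  obtain ⟨y', hy', hz⟩ := mem_mul.1 hz
  obtain rfl := mem_fun hy hy'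
  rw [hq _ _ hey hz, hq' _ _ hx hy, mul_assoc]

/-- The same `s` and `e` witness the degree of `[s, ζ]` for every `ζ` in the domain of `s` that
contains `e`. -/
theorem HasDegree.exists_isOpen {a : TightArrow C} {q : Q} (ha : HasDegree Λ a q) :
    ∃ V : Set (TightArrow C), IsOpen V ∧ a ∈ V ∧ ∀ b ∈ V, HasDegree Λ b q := by
  obtain ⟨s, hs, ξ, hd, rfl, e, he, hq⟩ := ha
  refine ⟨_, TightGerm.isOpen_basic hs (isOpen_setOf_mem_carrier (ξ.1.subset he)),
    TightGerm.mk_mem_basic.2 he, ?_⟩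
  rintro _ ⟨ζ, hζ, hd', rfl⟩
  exact ⟨s, hs, ζ, hd', rfl, e, hζ, hq⟩

theorem exists_hasDegree (hC : FinitelyAligned C) (a : TightArrow C) :
    ∃ q, HasDegree Λ a q := by
  obtain ⟨α, β, h, ξ, hβ, rfl⟩ := exists_eq_pathGerm hC a
  exact ⟨_, hasDegree_pathGerm h hβ⟩

variable (Λ)

/-- The degree cocycle `[τ^α σ^β, ξ] ↦ d(α) d(β)⁻¹`. -/
noncomputable def germDegree (hC : FinitelyAligned C) (a : TightArrow C) : Q :=
  (exists_hasDegree (Λ := Λ) hC a).choose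

variable {Λ} (hC : FinitelyAligned C)

/-- Uniqueness of the degree removes the dependence on the choice in `germDegree`; its algebraic and
topological properties are proved for `HasDegree` and transferred here. -/
theorem hasDegree_iff {a : TightArrow C} {q : Q} : HasDegree Λ a q ↔ germDegree Λ hC a = q :=
  have h := (exists_hasDegree (Λ := Λ) hC a).choose_spec
  ⟨fun h' => h.unique h', fun h' => h' ▸ h⟩

theorem germDegree_pathGerm {α β : Mor C} (h : α.s = β.s) {ξ : TightSpace C}
    (hβ : β ∈ delta ξ) :
    germDegree Λ hC (pathGerm α β h ξ hβ) = (Λ.deg α : Q) * (Λ.deg β : Q)⁻¹ :=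
  (hasDegree_iff hC).1 (hasDegree_pathGerm h hβ)

theorem germDegree_isCocycle :
    (tightGroupoid (pathSemigroup C)).IsCocycle (germDegree Λ hC) where
  map_mul _ _ h := (hasDegree_iff hC).1
    (((hasDegree_iff hC).2 rfl).mul ((hasDegree_iff hC).2 rfl) h)
  locallyConstant := (IsLocallyConstant.iff_exists_open _).2 fun a => by
    obtain ⟨V, hV, ha, h⟩ := ((hasDegree_iff (Λ := Λ) hC).2 (rfl : _ = germDegree Λ hC a)).exists_isOpen
    exact ⟨V, hV, ha, fun b hb => (hasDegree_iff hC).1 (h b hb)⟩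

end Degree

end LCSC
namespace LCSC

/-! ### The isomorphism onto the semigroup action groupoid -/

section Isomorphism

variable {Q : Type*} [Group Q] {Γ : Submonoid Q} {C : Type*} [Category C] [LeftCancellative C]
  {Λ : GammaGraph Γ C}

theorem hasDegree_unit (ξ : TightSpace C) : HasDegree Λ (TightGerm.unit ξ) 1 :=
  ⟨_, (ξ.1.subset ξ.1.nonempty.some_mem).1, ξ, unit_dom ξ.1.nonempty.some_mem, rfl, _,
    ξ.1.nonempty.some_mem, fun x y hx hy => by rw [one_mul, mem_fun hx hy]⟩

theorem germDegree_inv (hC : FinitelyAligned C) (a : TightArrow C) :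
    germDegree Λ hC a.inv = (germDegree Λ hC a)⁻¹ := by
  have h1 := (germDegree_isCocycle (Λ := Λ) hC).map_mul a.inv a
    ((tightGroupoid (pathSemigroup C)).src_inv a)
  have h2 : (tightGroupoid (pathSemigroup C)).mul a.inv a
      ((tightGroupoid (pathSemigroup C)).src_inv a) = TightGerm.unit a.src :=
    (tightGroupoid (pathSemigroup C)).inv_mul a
  rw [h2, (hasDegree_iff hC).1 (hasDegree_unit a.src)] at h1
  exact eq_inv_of_mul_eq_one_left h1.symm

theorem mem_shiftMap_pathAct {α β : Mor C} (h : α.s = β.s) {ξ : TightSpace C}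
    (hβ : β ∈ delta ξ) :
    shift β ξ hβ ∈ (shiftAction Λ).T (Λ.deg α) (pathAct α β h ξ hβ) :=
  (mem_shiftMap Λ).2 ⟨α, mem_delta_pathAct h hβ, rfl, (shift_pathAct h hβ).symm⟩

theorem mem_shiftMap_self {β : Mor C} {ξ : TightSpace C} (hβ : β ∈ delta ξ) :
    shift β ξ hβ ∈ (shiftAction Λ).T (Λ.deg β) ξ :=
  (mem_shiftMap Λ).2 ⟨β, hβ, rfl, rfl⟩

/-- An arrow of the action groupoid comes from paths `α`, `β` having exactly the degrees `g`, `h`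
that exhibit it, not merely the same quotient `g h⁻¹`. -/
theorem exists_pathAct_of_mem_shiftMap {g h : Γ} {x y z : TightSpace C}
    (hx : z ∈ (shiftAction Λ).T g x) (hy : z ∈ (shiftAction Λ).T h y) :
    ∃ (α β : Mor C) (hs : α.s = β.s) (hβ : β ∈ delta y), Λ.deg α = g ∧ Λ.deg β = h ∧
      x = pathAct α β hs y hβ := by
  obtain ⟨α, hα, hg, rfl⟩ := (mem_shiftMap Λ).1 hx
  obtain ⟨β, hβ, hh, hz⟩ := (mem_shiftMap Λ).1 hy
  exact ⟨α, β, source_eq_of_shift_eq hα hβ hz, hβ, hg, hh, eq_pathAct_of_shift_eq hα hβ hz⟩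

variable (Λ) (hC : FinitelyAligned C)

/-- The map `a ↦ (r(a), d̄(a), s(a))` from the tight groupoid to the action groupoid. -/
noncomputable def germToArrow (a : TightArrow C) : (shiftAction Λ).Arrow :=
  ⟨(a.rng, germDegree Λ hC a, a.src), by
    obtain ⟨α, β, h, ξ, hβ, rfl⟩ := exists_eq_pathGerm hC a
    exact ⟨Λ.deg α, Λ.deg β, germDegree_pathGerm hC h hβ, _, mem_shiftMap_pathAct h hβ,
      mem_shiftMap_self hβ⟩⟩

theorem germToArrow_pathGerm {α β : Mor C} (h : α.s = β.s) {ξ : TightSpace C}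
    (hβ : β ∈ delta ξ) : (germToArrow Λ hC (pathGerm α β h ξ hβ)).1 =
      (pathAct α β h ξ hβ, (Λ.deg α : Q) * (Λ.deg β : Q)⁻¹, ξ) :=
  Prod.ext rfl (Prod.ext (germDegree_pathGerm hC h hβ) rfl)

/-- The triple remembers only `d(α) d(β)⁻¹`, so the two germs are first given a common right path,
after which the degrees of the left paths can be compared. -/
theorem germToArrow_injective : Function.Injective (germToArrow Λ hC) := by
  intro a b hab
  obtain ⟨α, β, h, ξ, hβ, rfl⟩ := exists_eq_pathGerm hC a
  obtain ⟨γ, δ, h', ζ, hδ, rfl⟩ := exists_eq_pathGerm hC b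
  have hab' := congrArg Subtype.val hab
  obtain rfl : ξ = ζ := congrArg (fun p => p.2.2) hab'
  -- Here `ε = β β' = δ δ'` lies in `Δ_ξ`; the germs become those of `τ^{αβ'} σ^ε` and `τ^{γδ'}
  -- σ^ε`.
  obtain ⟨ε, hε, ⟨β', hβ'⟩, δ', hδ'⟩ := delta_directed hC hβ hδ
  obtain ⟨α', hα'⟩ := exists_isComp (h.trans hβ'.src_eq)
  obtain ⟨γ', hγ'⟩ := exists_isComp (h'.trans hδ'.src_eq)
  have hs : α'.s = ε.s := hα'.s_eq.trans hβ'.s_eq.symm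
  have hs' : γ'.s = ε.s := hγ'.s_eq.trans hδ'.s_eq.symm
  rw [pathGerm_comp h hβ hα' hβ' hs hε, pathGerm_comp h' hδ hγ' hδ' hs' hε] at hab' ⊢
  rw [germToArrow_pathGerm, germToArrow_pathGerm] at hab'
  have hdeg : Λ.deg α' = Λ.deg γ' :=
    Subtype.ext (mul_right_cancel (congrArg (fun p => p.2.1) hab'))
  have hact : pathAct α' ε hs ξ hε = pathAct γ' ε hs' ξ hε := congrArg Prod.fst hab'
  -- Both left paths lie in `Δ` of the common range filter and have equal degree.
  refine pathGerm_congr (delta_unique Λ (mem_delta_pathAct hs hε) ?_ hdeg) _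
  rw [hact]
  exact mem_delta_pathAct hs' hε

theorem germToArrow_surjective : Function.Surjective (germToArrow Λ hC) := by
  rintro ⟨⟨x, q, y⟩, g, h, hq, z, hx, hy⟩
  dsimp only at hq hx hy
  obtain ⟨α, β, hs, hβ, rfl, rfl, rfl⟩ := exists_pathAct_of_mem_shiftMap hx hy
  subst hq
  exact ⟨pathGerm α β hs y hβ, Subtype.ext (germToArrow_pathGerm Λ hC hs hβ)⟩

/-! ### Comparison of the topologies under `Φ` -/

theorem germToArrow_mem_Z {a : TightArrow C} {M N : Set (TightSpace C)} {g h : Γ}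
    (ha : germToArrow Λ hC a ∈ (shiftAction Λ).Z M g h N) :
    ∃ (α β : Mor C) (hs : α.s = β.s) (ξ : TightSpace C) (hβ : β ∈ delta ξ),
      Λ.deg α = g ∧ Λ.deg β = h ∧ a = pathGerm α β hs ξ hβ ∧ pathAct α β hs ξ hβ ∈ M ∧ ξ ∈ N := by
  obtain ⟨hM, hq, hN, z, hx, hy⟩ := ha
  obtain ⟨α, β, hs, hβ, hg, hh, hrng⟩ := exists_pathAct_of_mem_shiftMap hx hy
  -- The germ built from `α` and `β` has the same image under `Φ` as `a`, so injectivity identifies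
  -- it with `a`.
  refine ⟨α, β, hs, _, hβ, hg, hh, germToArrow_injective Λ hC (Subtype.ext ?_), hrng ▸ hM, hN⟩
  rw [germToArrow_pathGerm, ← hrng, hg, hh, ← hq]

theorem continuous_germToArrow : Continuous (germToArrow Λ hC) := by
  refine continuous_generateFrom_iff.2 ?_
  rintro _ ⟨M, g, h, N, hM, hN, -, -, -, -, -, rfl⟩
  refine isOpen_iff_forall_mem_open.2 fun a ha => ?_
  obtain ⟨α, β, hs, ξ, hβ, rfl, rfl, rfl, hξM, hξN⟩ := germToArrow_mem_Z Λ hC ha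
  have hS := (pathSemigroup C).mul_mem (tau_mem α) (sigma_mem β)
  -- The neighbourhood consists of the germs of `τ^α σ^β` with source in `N` and range in `M`;
  -- keeping `α` and `β` fixed keeps `g` and `h` fixed.
  refine ⟨_, ?_, TightGerm.isOpen_basic hS (hN.inter (TightFilter.isOpen_act_preimage hS hM)),
    TightGerm.mk_mem_basic.2 ⟨hξN, tauSigma_dom hs hβ, hξM⟩⟩
  rintro _ ⟨ζ, ⟨hζN, hd, hζM⟩, -, rfl⟩
  have hβ' := mem_delta_of_tauSigma_dom hd
  exact ⟨hζM, germDegree_pathGerm hC hs hβ', hζN, _, mem_shiftMap_pathAct hs hβ',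
    mem_shiftMap_self hβ'⟩

/-- When a single `α` lies in `Δ_ξ` for all `ξ ∈ M`, the map `T_g` with `g = d(α)` is `σ^α` on all
of `M`, and `σ^α` is injective. -/
theorem pInjOn_shiftAction {α : Mor C} {M : Set (TightSpace C)} (hM : ∀ ξ ∈ M, α ∈ delta ξ) :
    PInjOn ((shiftAction Λ).T (Λ.deg α)) M := by
  have key : ∀ {ξ z : TightSpace C} (hα : α ∈ delta ξ),
      z ∈ (shiftAction Λ).T (Λ.deg α) ξ → z = shift α ξ hα := fun hα hz =>
    Part.mem_unique hz (mem_shiftMap_self hα)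
  intro x hx y hy z hzx hzy
  exact shift_injective (hM x hx) (hM y hy) ((key _ hzx).symm.trans (key _ hzy))

/-- The image under `τ^α σ^β` is the preimage under its inverse `τ^β σ^α`. -/
theorem isOpen_pathAct_image {α β : Mor C} (h : α.s = β.s) {U : Set (TightSpace C)}
    (hU : IsOpen U) : IsOpen {x | ∃ ξ ∈ U, ∃ hβ : β ∈ delta ξ, x = pathAct α β h ξ hβ} := by
  convert TightFilter.isOpen_act_preimage ((pathSemigroup C).mul_mem (tau_mem β) (sigma_mem α))
    hU using 1
  ext x
  constructor
  · rintro ⟨ξ, hξ, hβ, rfl⟩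
    refine ⟨tauSigma_dom h.symm (mem_delta_pathAct h hβ), ?_⟩
    have h1 := eq_pathAct_of_shift_eq hβ (mem_delta_pathAct h hβ) (shift_pathAct h hβ).symm
    rw [h1] at hξ
    exact hξ
  · rintro ⟨hd, hx⟩
    have hα := mem_delta_of_tauSigma_dom hd
    exact ⟨_, hx, mem_delta_pathAct h.symm hα,
      eq_pathAct_of_shift_eq hα (mem_delta_pathAct h.symm hα) (shift_pathAct h.symm hα).symm⟩

/-- Around `Φ([τ^α σ^β, ξ])` the set `Z(M, d(α), d(β), N)` is used, where `N` is a small open set of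
filters `ζ` with `β ∈ Δ_ζ` and `M` is its image under `τ^α σ^β`. -/
theorem isOpenMap_germToArrow : IsOpenMap (germToArrow Λ hC) := by
  intro V hV
  refine isOpen_iff_forall_mem_open.2 ?_
  rintro _ ⟨a, ha, rfl⟩
  obtain ⟨α, β, h, ξ, hβ, rfl⟩ := exists_eq_pathGerm hC a
  obtain ⟨U, hU, hξ, hUV⟩ := TightGerm.exists_basic_subset hV ha
  have hN : IsOpen (U ∩ {ξ | β ∈ delta ξ}) :=
    hU.inter (isOpen_setOf_mem_carrier (tau_sigma_idem β))
  have hM := isOpen_pathAct_image h hN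
  refine ⟨(shiftAction Λ).Z {x | ∃ ζ ∈ U ∩ {ξ | β ∈ delta ξ}, ∃ hβ, x = pathAct α β h ζ hβ}
    (Λ.deg α) (Λ.deg β) (U ∩ {ξ | β ∈ delta ξ}), ?_, ?_, ?_⟩
  · rintro b hb
    obtain ⟨b, rfl⟩ := germToArrow_surjective Λ hC b
    refine ⟨b, ?_, rfl⟩
    obtain ⟨α', β', hs', ζ, hβ', hα, hβ'', rfl, ⟨ω, hω, hω', hact⟩, hζ⟩ :=
      germToArrow_mem_Z Λ hC hb
    -- An arrow of this `Z` is represented by `α'`, `β'` of the same degrees as `α`, `β`. Uniqueness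
    -- in `Δ` of the source and of the range forces `β' = β` and `α' = α`, so the germ lies in
    -- `Θ(τ^α σ^β, U)`.
    obtain rfl := delta_unique Λ hβ' hζ.2 hβ''
    have hα' : α ∈ delta (pathAct α' β' hs' ζ hβ') := by
      rw [hact]
      exact mem_delta_pathAct h hω'
    obtain rfl := delta_unique Λ (mem_delta_pathAct hs' hβ') hα' hα
    exact hUV (TightGerm.mk_mem_basic.2 hζ.1)
  · refine TopologicalSpace.isOpen_generateFrom_of_mem
      ⟨_, _, _, _, hM, hN, ?_, ?_, ?_, ?_, ?_, rfl⟩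
    · rintro _ ⟨ζ, -, hβ', rfl⟩
      exact ⟨α, mem_delta_pathAct h hβ', rfl⟩
    · exact fun ζ hζ => ⟨β, hζ.2, rfl⟩
    · refine pInjOn_shiftAction Λ ?_
      rintro _ ⟨ζ, -, hβ', rfl⟩
      exact mem_delta_pathAct h hβ'
    · exact pInjOn_shiftAction Λ fun ζ hζ => hζ.2
    -- Both images equal `σ^β · N`, because `σ^α` undoes `τ^α` on `M`.
    · ext z
      constructor
      · rintro ⟨_, ⟨ζ, hζ, hβ', rfl⟩, hz⟩
        rw [Part.mem_unique hz (mem_shiftMap_pathAct h hβ')]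
        exact ⟨ζ, hζ, mem_shiftMap_self hβ'⟩
      · rintro ⟨ζ, hζ, hz⟩
        rw [Part.mem_unique hz (mem_shiftMap_self hζ.2)]
        exact ⟨_, ⟨ζ, hζ, hζ.2, rfl⟩, mem_shiftMap_pathAct h hζ.2⟩
  · exact ⟨⟨ξ, ⟨hξ, hβ⟩, hβ, rfl⟩, germDegree_pathGerm hC h hβ, ⟨hξ, hβ⟩, _,
      mem_shiftMap_pathAct h hβ, mem_shiftMap_self hβ⟩

/-- The isomorphism `Φ` from the tight groupoid to the semigroup action groupoid. -/
noncomputable def tightIsoAction (hΓ : IsJoinSemilattice Γ) :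
    TopGroupoidIso (tightGroupoid (pathSemigroup C))
      (actionGroupoid (shiftAction Λ) (shiftAction_directed Λ hΓ hC)) where
  arrows := (Equiv.ofBijective (germToArrow Λ hC)
    ⟨germToArrow_injective Λ hC, germToArrow_surjective Λ hC⟩).toHomeomorphOfContinuousOpen
      (continuous_germToArrow Λ hC) (isOpenMap_germToArrow Λ hC)
  units := Homeomorph.refl _
  map_src _ := rfl
  map_rng _ := rfl
  -- Arrows of the action groupoid are determined by their triples: the outer coordinates are
  -- handled by the groupoid axioms for range and source, the middle one by the degree cocycle.
  map_unit ξ := Subtype.ext (Prod.ext ((tightGroupoid (pathSemigroup C)).rng_unit ξ)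
    (Prod.ext ((hasDegree_iff hC).1 (hasDegree_unit ξ)) rfl))
  map_inv a := Subtype.ext (Prod.ext ((tightGroupoid (pathSemigroup C)).rng_inv a)
    (Prod.ext (germDegree_inv hC a) ((tightGroupoid (pathSemigroup C)).src_inv a)))
  map_mul a b h := Subtype.ext (Prod.ext ((tightGroupoid (pathSemigroup C)).rng_mul a b h)
    (Prod.ext ((germDegree_isCocycle hC).map_mul a b h)
      ((tightGroupoid (pathSemigroup C)).src_mul a b h)))

theorem cocycle_isCocycle (hΓ : IsJoinSemilattice Γ) :
    (actionGroupoid (shiftAction Λ) (shiftAction_directed Λ hΓ hC)).IsCocycle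
      (shiftAction Λ).cocycle where
  map_mul _ _ _ := rfl
  locallyConstant := by
    -- Local constancy is inherited from the tight groupoid through `c̄ = d̄ ∘ Φ⁻¹`.
    have h : (shiftAction Λ).cocycle = germDegree Λ hC ∘ (tightIsoAction Λ hC hΓ).arrows.symm := by
      ext a
      obtain ⟨b, rfl⟩ := (tightIsoAction Λ hC hΓ).arrows.surjective a
      rw [Function.comp_apply, Homeomorph.symm_apply_apply]
      rfl
    rw [h]
    exact (germDegree_isCocycle hC).locallyConstant.comp_continuous
      (tightIsoAction Λ hC hΓ).arrows.symm.continuous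

end Isomorphism

end LCSC

/-! ### The main theorem -/

theorem mainTheorem10 {Q : Type*} [Group Q] (Γ : Submonoid Q) (hΓ : IsJoinSemilattice Γ)
    (C : Type*) [Category C] [LeftCancellative C] (hC : FinitelyAligned C)
    (Λ : GammaGraph Γ C) :
    -- both groupoids are topological groupoids
    (tightGroupoid (pathSemigroup C)).IsTopological ∧
    (actionGroupoid (shiftAction Λ) (shiftAction_directed Λ hΓ hC)).IsTopological ∧
    -- every arrow of the tight groupoid is a germ `[τ^α σ^β, ξ]`
    (∀ a : TightArrow C, ∃ (α β : Mor C) (h : α.s = β.s) (ξ : TightSpace C) (hβ : β ∈ delta ξ),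
      a = pathGerm α β h ξ hβ) ∧
    -- the canonical cocycles and the isomorphism `Φ`
    ∃ (d : TightArrow C → Q)
      (Φ : TopGroupoidIso (tightGroupoid (pathSemigroup C))
        (actionGroupoid (shiftAction Λ) (shiftAction_directed Λ hΓ hC))),
      (∀ (α β : Mor C) (h : α.s = β.s) (ξ : TightSpace C) (hβ : β ∈ delta ξ),
        d (pathGerm α β h ξ hβ) = (Λ.deg α : Q) * (Λ.deg β : Q)⁻¹) ∧
      (tightGroupoid (pathSemigroup C)).IsCocycle d ∧
      (actionGroupoid (shiftAction Λ) (shiftAction_directed Λ hΓ hC)).IsCocycle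
        (shiftAction Λ).cocycle ∧
      (∀ (α β : Mor C) (h : α.s = β.s) (ξ : TightSpace C) (hβ : β ∈ delta ξ),
        (Φ.arrows (pathGerm α β h ξ hβ)).1 =
          (pathAct α β h ξ hβ, (Λ.deg α : Q) * (Λ.deg β : Q)⁻¹, ξ)) ∧
      (∀ a : TightArrow C, (shiftAction Λ).cocycle (Φ.arrows a) = d a) :=
  ⟨tightGroupoid_isTopological _,
    (tightIsoAction Λ hC hΓ).isTopological (tightGroupoid_isTopological _),
    exists_eq_pathGerm hC, germDegree Λ hC, tightIsoAction Λ hC hΓ,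
    fun _ _ h _ hβ => germDegree_pathGerm hC h hβ, germDegree_isCocycle hC,
    cocycle_isCocycle Λ hC hΓ, fun _ _ h _ hβ => germToArrow_pathGerm Λ hC h hβ, fun _ => rfl⟩
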